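/- Let $q=0.1$, and for $Q>2$ put $r=2-1/Q$. Given $\delta_0\in(0,q)$, $\alpha_0>0$, an orthonormal basis $\mathbf a,\mathbf b$ of $\mathbb R^2$ and $N\in\mathbb N$, define a $2\times2$ matrix weight $W=W_{Q,\delta_0}$ on $I^0=[0,1)$ as follows. Put $\beta_0=\alpha_0(\delta_0/q)^2$, $\alpha_0^\#=Q/\beta_0$, $\beta_0^\#=Q/\alpha_0$, and for $n\ge 0$, with $\delta_n=q(\beta_n/\alpha_n)^{1/2}$, $$\widetilde\alpha_n=\frac{\alpha_n-\delta_n^2\beta_n}{1-\delta_n^2},\quad \widetilde\beta_n=\frac{\beta_n-\delta_n^2\alpha_n}{1-\delta_n^2},\quad \widetilde\alpha_n^\#=\frac{\alpha_n^\#-\delta_n^2\beta_n^\#}{1-\delta_n^2},\quad \widetilde\beta_n^\#=\frac{\beta_n^\#-\delta_n^2\alpha_n^\#}{1-\delta_n^2},\quad s_n=\widetilde\alpha_n\widetilde\beta_n^\#/Q,$$ $$\alpha_{n+1}=r\widetilde\alpha_n,\quad \beta_{n+1}=\frac{\widetilde\beta_n}{s_nr},\quad \alpha^\#_{n+1}=r\widetilde\alpha^\#_n,\quad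 \beta^\#_{n+1}=\frac{\widetilde\beta^\#_n}{s_nr}.$$ Let $I_-,I_+$ denote the left and right halves of a dyadic interval $I$. Let $I^0$ be the only stopping interval of generation $0$, with axes $\mathbf a_{I^0}=\mathbf a$, $\mathbf b_{I^0}=\mathbf b$. If $I$ is a stopping interval of generation $n<N$ with axes $\mathbf a_I,\mathbf b_I$, put $\mathbf a_{I_\pm}=(1+\delta_n^2)^{-1/2}(\mathbf a_I\pm\delta_n\mathbf b_I)$ and $\mathbf b_{I_\pm}=(1+\delta_n^2)^{-1/2}(\mathbf b_I\mp\delta_n\mathbf a_I)$. For each $J\in\{I_-,I_+\}$, the right half $J_+$ is a stopping interval of generation $n+1$ with axes $\mathbf a_J,\mathbf b_J$, and the left half $J_-$ is a terminal interval. For a positive definite pair $(\mathbf w,\mathbf v)$ with $\mathbf v^{-1}\le\mathbf w$, "stopping on $K$ with averages $(\mathbf w,\mathbf v)$" means setting $W=\mathbf w^{1/2}(\mathbf I\pm\Delta)\mathbf w^{1/2}$ on $K_\pm$, where $\Delta=(\mathbf I-\mathbf w^{-1/2}\mathbf v^{-1}\mathbf w^{-1/2})^{1/2}$; then $\langle W\rangle_K=\mathbf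 w$ and $\langle W^{-1}\rangle_K=\mathbf v$. On each terminal interval $J_-$ as above $W$ is obtained by stopping with $$\mathbf v=(2-r)\widetilde\alpha_n\mathbf a_J\mathbf a_J^*+\Bigl(2-\frac1{s_nr}\Bigr)\widetilde\beta_n\mathbf b_J\mathbf b_J^*,\qquad \mathbf w=\Bigl(2-\frac1{s_nr}\Bigr)\widetilde\beta_n^\#\mathbf a_J\mathbf a_J^*+(2-r)\widetilde\alpha_n^\#\mathbf b_J\mathbf b_J^*,$$ and on each stopping interval $I$ of the last generation $N$ by stopping with $\mathbf v=\alpha_N\mathbf a_I\mathbf a_I^*+\beta_N\mathbf b_I\mathbf b_I^*$, $\mathbf w=\beta_N^\#\mathbf a_I\mathbf a_I^*+\alpha_N^\#\mathbf b_I\mathbf b_I^*$. Let $\mathscr D$ be the set of dyadic subintervals of $I^0$, let $h_I=|I|^{-1/2}(\mathbf 1_{I_+}-\mathbf 1_{I_-})$, and let $$Ш f=\sum_{I\in\mathscr D}(f,h_I)\,[h_{I_+}-h_{I_-}],\qquad (f,h_I)=\int f h_I\in\mathbb R^2,\qquad \|g\|_{L^2(W)}^2=\int_{I^0}(W(x)g(x),g(x))\,dx$$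 (the classical Haar shift and the weighted norm). **Theorem.** There is an absolute constant $c>0$ such that for all sufficiently large $Q$, all sufficiently small $\delta_0>0$ (depending on $Q$) and all sufficiently large $N$ (depending on $Q$ and $\delta_0$), and for all $\alpha_0>0$ and all orthonormal bases $\mathbf a,\mathbf b$ of $\mathbb R^2$, the following holds for the weight $W$ above. The values of $W$ are positive definite, $W$ and $W^{-1}$ are integrable, and the dyadic matrix $\mathbf A_2$ characteristic of $W$ equals $Q$: $$\sup_{I\in\mathscr D}\bigl\|\langle W\rangle_I^{1/2}\langle W^{-1}\rangle_I^{1/2}\bigr\|^2=Q.$$ Moreover, for $f=\mathbf 1_{I^0}W^{-1}e$ with $e=\mathbf a$ or $e=\mathbf a+\mathbf b$: $f\in L^2(W)$, $f\neq0$ in $L^2(W)$, only finitely many of the coefficients $(f,h_I)$ are non-zero, $Ш f\in L^2(W)$, and $$\|Ш f\|_{L^2(W)}\ \ge\ c\,Q^{3/2}\,\|f\|_{L^2(W)}.$$ -/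

import Mathlib

open MeasureTheory

noncomputable section

namespace HaarLower

/-- The plane `ℝ²` with its Euclidean inner product. -/
abbrev Plane : Type := EuclideanSpace ℝ (Fin 2)

/-- Real `2 × 2` matrices. -/
abbrev Mat : Type := Matrix (Fin 2) (Fin 2) ℝ

/-- The unit interval `I⁰ = [0,1)`. -/
def unitInterval : Set ℝ := Set.Ico 0 1

/-- The action of a matrix on a vector of the plane. -/
def act (A : Mat) (x : Plane) : Plane := WithLp.toLp 2 (A.mulVec x.ofLp)

/-- The matrix `x • a a* + y • b b*`. -/
def diagMat (a b : Plane) (x y : ℝ) : Mat :=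
  x • Matrix.vecMulVec a.ofLp a.ofLp + y • Matrix.vecMulVec b.ofLp b.ofLp

/-! ### Dyadic intervals and Haar functions -/

/-- The dyadic subintervals of `[0,1)`: the pair `⟨k, j⟩` with `0 ≤ j < 2 ^ k` stands for the
interval `[j 2⁻ᵏ, (j+1) 2⁻ᵏ)`. -/
abbrev DyadicInterval : Type := Σ k : ℕ, Fin (2 ^ k)

namespace DyadicInterval

/-- The interval itself. -/
def set (I : DyadicInterval) : Set ℝ :=
  Set.Ico ((I.2 : ℝ) / 2 ^ I.1) (((I.2 : ℝ) + 1) / 2 ^ I.1)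

/-- The length `|I|`. -/
def length (I : DyadicInterval) : ℝ := ((2 : ℝ) ^ I.1)⁻¹

/-- The left child `I₋`. -/
def left (I : DyadicInterval) : DyadicInterval :=
  ⟨I.1 + 1, ⟨2 * (I.2 : ℕ), by have := I.2.isLt; rw [pow_succ]; omega⟩⟩

/-- The right child `I₊`. -/
def right (I : DyadicInterval) : DyadicInterval :=
  ⟨I.1 + 1, ⟨2 * (I.2 : ℕ) + 1, by have := I.2.isLt; rw [pow_succ]; omega⟩⟩

/-- The `L²`-normalized Haar function `h_I = |I|^{-1/2} (1_{I₊} - 1_{I₋})`. -/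
def haar (I : DyadicInterval) (x : ℝ) : ℝ :=
  (Real.sqrt I.length)⁻¹ * (I.right.set.indicator 1 x - I.left.set.indicator 1 x)

end DyadicInterval

/-- The (vector) Haar coefficient `(f, h_I) = ∫ f h_I`. -/
def haarCoeff (f : ℝ → Plane) (I : DyadicInterval) : Plane := ∫ x, I.haar x • f x

/-- The classical Haar shift `Ш f = ∑_{I ∈ 𝒟} (f, h_I) (h_{I₊} - h_{I₋})`, as a pointwise series.
It is applied below only to functions with finitely many non-zero Haar coefficients. -/
def haarShift (f : ℝ → Plane) (x : ℝ) : Plane :=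
  ∑' I : DyadicInterval, (I.right.haar x - I.left.haar x) • haarCoeff f I

/-! ### Matrix weights on `[0,1)` -/

/-- A `2 × 2` matrix weight on `[0,1)`: an integrable function with values in the positive
semidefinite matrices. -/
def IsMatrixWeight (W : ℝ → Mat) : Prop :=
  (∀ x ∈ unitInterval, (W x).PosSemidef) ∧
    ∀ i j, IntegrableOn (fun x => W x i j) unitInterval

/-- The average `⟨W⟩_I = |I|⁻¹ ∫_I W`. -/
def average (W : ℝ → Mat) (I : DyadicInterval) : Mat :=
  Matrix.of fun i j => I.length⁻¹ * ∫ x in I.set, W x i j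

/-- The norm of a matrix as an operator on the Euclidean plane. -/
def opNorm (A : Mat) : ℝ := ‖Matrix.toEuclideanCLM (n := Fin 2) (𝕜 := ℝ) A‖

open scoped MatrixOrder in
/-- The positive square root of a positive semidefinite matrix. -/
def sqrtMat (A : Mat) : Mat := CFC.sqrt A

/-- `Q` is the dyadic matrix `A₂` characteristic of `W`:
`Q = sup_{I ∈ 𝒟} ‖⟨W⟩_I^{1/2} ⟨W⁻¹⟩_I^{1/2}‖²` (in particular, the supremum is finite). -/
def HasDyadicA2Char (W : ℝ → Mat) (Q : ℝ) : Prop :=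
  IsLUB (Set.range fun I : DyadicInterval =>
    opNorm (sqrtMat (average W I) * sqrtMat (average (fun x => (W x)⁻¹) I)) ^ 2) Q

/-- Membership of (the restriction to `[0,1)` of) `g` in `L²(W)`. -/
def MemL2 (W : ℝ → Mat) (g : ℝ → Plane) : Prop :=
  AEStronglyMeasurable g (volume.restrict unitInterval) ∧
    IntegrableOn (fun x => inner ℝ (act (W x) (g x)) (g x)) unitInterval

/-- The norm of `L²(W)`: `‖g‖² = ∫ (W g, g)` over `[0,1)`. -/
def normL2 (W : ℝ → Mat) (g : ℝ → Plane) : ℝ :=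
  Real.sqrt (∫ x in unitInterval, inner ℝ (act (W x) (g x)) (g x))

/-! ### The weight -/

/-- The small parameter `q = 0.1`. -/
def q : ℝ := 1 / 10

/-- The stretching parameter `r = 2 - 1/Q`. -/
def stretch (Q : ℝ) : ℝ := 2 - 1 / Q

/-- The eigenvalues `α, β, α#, β#`: in the principal axes `a`, `b` of an interval the average of
`W⁻¹` is `α a a* + β b b*`, and the average of `W` is `β# a a* + α# b b*`. -/
structure Eig where
  al : ℝ
  be : ℝ
  alS : ℝ
  beS : ℝ

namespace Eig

/-- The rotation parameter `δ = q (β/α)^{1/2}`. -/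
def delta (p : Eig) : ℝ := q * Real.sqrt (p.be / p.al)

/-- The eigenvalues `α̃, β̃, α̃#, β̃#` after the rotation. -/
def rotated (p : Eig) : Eig where
  al := (p.al - p.delta ^ 2 * p.be) / (1 - p.delta ^ 2)
  be := (p.be - p.delta ^ 2 * p.al) / (1 - p.delta ^ 2)
  alS := (p.alS - p.delta ^ 2 * p.beS) / (1 - p.delta ^ 2)
  beS := (p.beS - p.delta ^ 2 * p.alS) / (1 - p.delta ^ 2)

/-- The ratio `s = α̃ β̃# / Q`. -/
def ratio (Q : ℝ) (p : Eig) : ℝ := p.rotated.al * p.rotated.beS / Q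

/-- The eigenvalues on the right (stopping) child after rotation and stretching:
`(x, y) ↦ (r x, y / (s r))` for `(x, y) = (α̃, β̃#)` and `(x, y) = (α̃#, β̃)`. -/
def next (Q : ℝ) (p : Eig) : Eig where
  al := stretch Q * p.rotated.al
  be := p.rotated.be / (p.ratio Q * stretch Q)
  alS := stretch Q * p.rotated.alS
  beS := p.rotated.beS / (p.ratio Q * stretch Q)

/-- The eigenvalues on the left (terminal) child after rotation and stretching:
`(x, y) ↦ ((2 - r) x, (2 - 1 / (s r)) y)`. -/
def terminal (Q : ℝ) (p : Eig) : Eig where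
  al := (2 - stretch Q) * p.rotated.al
  be := (2 - 1 / (p.ratio Q * stretch Q)) * p.rotated.be
  alS := (2 - stretch Q) * p.rotated.alS
  beS := (2 - 1 / (p.ratio Q * stretch Q)) * p.rotated.beS

/-- The initial eigenvalues: `δ₀ = q (β₀/α₀)^{1/2}`, `α₀ β₀# = β₀ α₀# = Q`. -/
def initial (Q δ₀ α₀ : ℝ) : Eig where
  al := α₀
  be := α₀ * (δ₀ / q) ^ 2
  alS := Q / (α₀ * (δ₀ / q) ^ 2)
  beS := Q / α₀

end Eig

/-- The rotated vector `(1+δ²)^{-1/2} (u + δ v)`. -/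
def turn (δ : ℝ) (u v : Plane) : Plane := (Real.sqrt (1 + δ ^ 2))⁻¹ • (u + δ • v)

/-- The weight on `[0,1)` that is constant on the two halves, with average
`w = β# a a* + α# b b*` and with average of the inverse equal to `v = α a a* + β b b*`.
It equals `w^{1/2} (1 + Δ) w^{1/2}` on the right half and `w^{1/2} (1 - Δ) w^{1/2}` on the left one,
where `Δ = (1 - w^{-1/2} v⁻¹ w^{-1/2})^{1/2}`, written out in the common eigenbasis. -/
def stopWeight (p : Eig) (a b : Plane) (x : ℝ) : Mat :=
  let da := Real.sqrt (1 - 1 / (p.al * p.beS))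
  let db := Real.sqrt (1 - 1 / (p.be * p.alS))
  if x < 1 / 2 then diagMat a b (p.beS * (1 - da)) (p.alS * (1 - db))
  else diagMat a b (p.beS * (1 + da)) (p.alS * (1 + db))

/-- The weight on a stopping interval with eigenvalues `p` and principal axes `a`, `b`, when `N`
further generations of stopping intervals are to be constructed. The interval is transported
affinely onto `[0,1)`, and so are its quarters: from left to right `I₋₋` (terminal), `I₋₊`
(stopping), `I₊₋` (terminal), `I₊₊` (stopping). The axes on `I_±` are
`(1+δ²)^{-1/2} (a ± δ b)` and `(1+δ²)^{-1/2} (b ∓ δ a)`. -/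
def weightAux (Q : ℝ) : ℕ → Eig → Plane → Plane → ℝ → Mat
  | 0, p, a, b, x => stopWeight p a b x
  | N + 1, p, a, b, x =>
    let δ := p.delta
    if x < 1 / 4 then
      stopWeight (p.terminal Q) (turn (-δ) a b) (turn δ b a) (4 * x)
    else if x < 1 / 2 then
      weightAux Q N (p.next Q) (turn (-δ) a b) (turn δ b a) (4 * x - 1)
    else if x < 3 / 4 then
      stopWeight (p.terminal Q) (turn δ a b) (turn (-δ) b a) (4 * x - 2)
    else
      weightAux Q N (p.next Q) (turn δ a b) (turn (-δ) b a) (4 * x - 3)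

/-- The dyadic weight `W = W_{Q, δ₀}` on `[0,1)`, with initial eigenvalue `α₀` and initial principal
axes `u 0 = a_{I⁰}`, `u 1 = b_{I⁰}`, terminated at the stopping intervals of generation `N`. -/
def weight (Q δ₀ α₀ : ℝ) (u : OrthonormalBasis (Fin 2) ℝ Plane) (N : ℕ) : ℝ → Mat :=
  weightAux Q N (Eig.initial Q δ₀ α₀) (u 0) (u 1)

/-- The test function `f = 1_{I⁰} W⁻¹ e`. -/
def testFunction (W : ℝ → Mat) (e : Plane) : ℝ → Plane :=
  unitInterval.indicator fun x => act (W x)⁻¹ e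

end HaarLower

end

noncomputable section

namespace HaarLower

/-! ### Step functions described by binary trees -/

/-! The weight is a step function on a finite binary tree, so its averages, Haar coefficients and
weighted norms all obey recursions over the two halves of an interval.

On a stopping interval `⟨W⟩ = Q ⟨W⁻¹⟩⁻¹`, and `D = det ⟨W⁻¹⟩` is the same in every generation
(`Eig.Valid`, `Eig.Valid.next`). All averages of `W` and `W⁻¹` over one interval have common axes,
and their product is a scalar, equal to `Q` on stopping intervals and at most `Q` elsewhere. This
gives the characteristic.

For `f = W⁻¹ e` one has `W f = e`, hence `‖f‖² = (⟨W⁻¹⟩ e, e)`, which is at most `2 α₀`. On a given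
interval `Ш f` has the form `G + sgn • P + (shift of the part of f inside)`, where `G` is inherited
from higher ancestors and `P` comes from the Haar coefficient of the parent; `Tree.energy` is the
weighted norm squared of such a function. Since `e` stays near the axis `a`, the stretching makes
the `a`-component of `P` at least `α/4`. The two halves carry `G ∓ P`, and their second axes are
tilted by `±δ` towards `a`. Both signs flip together, so the mean of `-(b, G)` over the halves grows
by about `δ (a, P)`, without cancellation. The perturbation by the rotation jump is at most half of
`α/4`, and `α δ = √D / 10` is constant, so every generation adds at least `√D / 80`, up to the
normalizing factor of the rotation.

Thus after `n` generations the component of `Ш f` along `b` is of size `n √D` on average. Terminal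
intervals `n` generations down fill the proportion `2^{-n-1}`, and there `W` in the direction `b` is
at least of order `α rⁿ / D`. By convexity (`two_mul_posSq_le`) they contribute about `α n² (r/2)ⁿ`
(`energy_ge`). Because `r/2 = 1 - 1/(2Q)`, the power is at least `1/2` for `n ≤ Q`
(`half_le_stretch_pow`), and the sum over these `n` is of order `α Q³` (`energy_zero_ge_cube`).
Square roots give `Q^{3/2}`. -/

/-- A dyadic step function on `[0,1)`, given by its values at the leaves of a binary tree. -/
inductive Tree (X : Type) : Type
  | leaf : X → Tree X
  | node : Tree X → Tree X → Tree X

namespace Tree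

variable {X Y : Type}

/-- The step function described by a tree. -/
def eval : Tree X → ℝ → X
  | leaf v, _ => v
  | node l r, x => if x < 1 / 2 then eval l (2 * x) else eval r (2 * x - 1)

/-- Apply a function to all values. -/
def map (φ : X → Y) : Tree X → Tree Y
  | leaf v => leaf (φ v)
  | node l r => node (map φ l) (map φ r)

/-- The average over `[0,1)`. -/
def mean [AddCommGroup X] [Module ℝ X] : Tree X → X
  | leaf v => v
  | node l r => (1 / 2 : ℝ) • (mean l + mean r)

/-- All values satisfy `P`. -/
def All (P : X → Prop) : Tree X → Prop
  | leaf v => P v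
  | node l r => All P l ∧ All P r

theorem All.eval {P : X → Prop} : ∀ {t : Tree X}, t.All P → ∀ x, P (t.eval x)
  | leaf _, h, _ => h
  | node l r, h, x => by
    simp only [Tree.eval]
    split_ifs
    · exact h.1.eval _
    · exact h.2.eval _

theorem eval_map (φ : X → Y) : ∀ (t : Tree X) (x : ℝ), (t.map φ).eval x = φ (t.eval x)
  | leaf _, _ => rfl
  | node l r, x => by
    simp only [eval, map]
    split_ifs
    · exact eval_map φ l _
    · exact eval_map φ r _

theorem mean_map [AddCommGroup X] [Module ℝ X] [AddCommGroup Y] [Module ℝ Y] (φ : X →ₗ[ℝ] Y) :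
    ∀ t : Tree X, (t.map φ).mean = φ t.mean
  | leaf _ => rfl
  | node l r => by simp only [mean, map, mean_map φ l, mean_map φ r, map_smul, map_add]

theorem map_map {Z : Type} (φ : X → Y) (ψ : Y → Z) :
    ∀ t : Tree X, (t.map φ).map ψ = t.map fun v => ψ (φ v)
  | leaf _ => rfl
  | node l r => by simp only [map, map_map φ ψ l, map_map φ ψ r]

theorem stronglyMeasurable_eval [TopologicalSpace X] : ∀ t : Tree X, StronglyMeasurable t.eval
  | leaf _ => stronglyMeasurable_const
  | node l r => by
    refine StronglyMeasurable.ite (measurableSet_lt measurable_id measurable_const) ?_ ?_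
    · exact (stronglyMeasurable_eval l).comp_measurable (measurable_const.mul measurable_id)
    · exact (stronglyMeasurable_eval r).comp_measurable
        ((measurable_const.mul measurable_id).sub_const 1)

end Tree

/-! ### Halving the unit interval -/

section halving

variable {F : Type} [NormedAddCommGroup F]

theorem integrable_comp_two_mul_sub_one {g : ℝ → F} (hg : Integrable g) :
    Integrable fun x => g (2 * x - 1) :=
  (hg.comp_sub_right 1).comp_mul_left' (R := 2) two_ne_zero

theorem integrableOn_const_unitInterval (c : F) : IntegrableOn (fun _ => c) unitInterval :=
  integrableOn_const (by simp [unitInterval])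

theorem measurableSet_unitInterval : MeasurableSet unitInterval := measurableSet_Ico

variable [NormedSpace ℝ F]

theorem integral_comp_two_mul (g : ℝ → F) : ∫ x, g (2 * x) = (1 / 2 : ℝ) • ∫ x, g x := by
  rw [Measure.integral_comp_mul_left g 2]
  norm_num

theorem integral_comp_two_mul_sub_one (g : ℝ → F) :
    ∫ x, g (2 * x - 1) = (1 / 2 : ℝ) • ∫ x, g x := by
  rw [Measure.integral_comp_mul_left (fun x => g (x - 1)) 2, integral_sub_right_eq_self g 1]
  norm_num

theorem indicator_unitInterval_halves {E : Type} [AddMonoid E] {h hl hr : ℝ → E}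
    (h₀ : ∀ x, 0 ≤ x → x < 1 / 2 → h x = hl (2 * x))
    (h₁ : ∀ x, 1 / 2 ≤ x → x < 1 → h x = hr (2 * x - 1)) (x : ℝ) :
    unitInterval.indicator h x =
      unitInterval.indicator hl (2 * x) + unitInterval.indicator hr (2 * x - 1) := by
  simp only [unitInterval, Set.indicator_apply, Set.mem_Ico]
  by_cases hx : 0 ≤ x
  · by_cases hx' : x < 1 / 2
    · rw [if_pos ⟨hx, by linarith⟩, if_pos ⟨by linarith, by linarith⟩,
        if_neg (fun h => by linarith [h.1]), add_zero, h₀ x hx hx']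
    · by_cases hx1 : x < 1
      · rw [if_pos ⟨hx, hx1⟩, if_neg (fun h => by linarith [h.2]),
          if_pos ⟨by linarith, by linarith⟩, zero_add, h₁ x (by linarith) hx1]
      · rw [if_neg (fun h => hx1 h.2), if_neg (fun h => by linarith [h.2]),
          if_neg (fun h => by linarith [h.2]), add_zero]
  · rw [if_neg (fun h => hx h.1), if_neg (fun h => by linarith [h.1]),
      if_neg (fun h => by linarith [h.1]), add_zero]

/-- This is the induction step for every integral over a tree: each half is rescaled to `[0,1)`. -/
theorem integral_unitInterval_halves {h hl hr : ℝ → F}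
    (h₀ : ∀ x, 0 ≤ x → x < 1 / 2 → h x = hl (2 * x))
    (h₁ : ∀ x, 1 / 2 ≤ x → x < 1 → h x = hr (2 * x - 1))
    (hli : IntegrableOn hl unitInterval) (hri : IntegrableOn hr unitInterval) :
    IntegrableOn h unitInterval ∧ ∫ x in unitInterval, h x =
      (1 / 2 : ℝ) • ((∫ x in unitInterval, hl x) + ∫ x in unitInterval, hr x) := by
  have key := indicator_unitInterval_halves h₀ h₁
  have hl' := (integrable_indicator_iff measurableSet_unitInterval).2 hli
  have hr' := (integrable_indicator_iff measurableSet_unitInterval).2 hri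
  have il := hl'.comp_mul_left' (R := 2) two_ne_zero
  have ir := integrable_comp_two_mul_sub_one hr'
  constructor
  · rw [← integrable_indicator_iff measurableSet_unitInterval]
    exact (il.add ir).congr (Filter.Eventually.of_forall fun x => (key x).symm)
  · rw [← integral_indicator measurableSet_unitInterval,
      ← integral_indicator measurableSet_unitInterval,
      ← integral_indicator measurableSet_unitInterval, integral_congr_ae
        (Filter.Eventually.of_forall key), integral_add il ir, integral_comp_two_mul,
      integral_comp_two_mul_sub_one, smul_add]

theorem volume_real_unitInterval : volume.real unitInterval = 1 := by
  simp [unitInterval, Measure.real]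

theorem integral_const_unitInterval [CompleteSpace F] (c : F) :
    ∫ _ in unitInterval, c = c := by
  rw [setIntegral_const, volume_real_unitInterval, one_smul]

theorem Tree.integral_eval [CompleteSpace F] : ∀ t : Tree F,
    IntegrableOn t.eval unitInterval ∧ ∫ x in unitInterval, t.eval x = t.mean
  | .leaf c => ⟨integrableOn_const_unitInterval c, integral_const_unitInterval c⟩
  | .node l r => by
    obtain ⟨hl, hl'⟩ := Tree.integral_eval l
    obtain ⟨hr, hr'⟩ := Tree.integral_eval r
    have := integral_unitInterval_halves (h := (Tree.node l r).eval) (hl := l.eval) (hr := r.eval)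
      (fun x _ hx => by simp only [Tree.eval, if_pos hx])
      (fun x hx _ => by simp only [Tree.eval, if_neg (not_lt.2 hx)]) hl hr
    rw [hl', hr'] at this
    exact this

end halving

/-! ### Dyadic intervals of the two halves -/

namespace DyadicInterval

/-- The interval `[0,1)` itself. -/
def root : DyadicInterval := ⟨0, 0⟩

/-- The image of a dyadic interval under `x ↦ x / 2`. -/
def lower (I : DyadicInterval) : DyadicInterval :=
  ⟨I.1 + 1, ⟨I.2, by have := I.2.isLt; rw [pow_succ]; omega⟩⟩

/-- The image of a dyadic interval under `x ↦ (x + 1) / 2`. -/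
def upper (I : DyadicInterval) : DyadicInterval :=
  ⟨I.1 + 1, ⟨2 ^ I.1 + I.2, by have := I.2.isLt; rw [pow_succ]; omega⟩⟩

/-- Trees branch from the top, so induction along a tree needs intervals sorted by the half of
`[0,1)` that contains them, and not by their parents. -/
theorem eq_root_or (I : DyadicInterval) : I = root ∨ (∃ J, I = lower J) ∨ ∃ J, I = upper J := by
  obtain ⟨k, j, hj⟩ := I
  cases k with
  | zero =>
    left
    have : j = 0 := by simpa using hj
    subst this
    rfl
  | succ k =>
    right
    by_cases h : j < 2 ^ k
    · exact Or.inl ⟨⟨k, ⟨j, h⟩⟩, rfl⟩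
    · refine Or.inr ⟨⟨k, ⟨j - 2 ^ k, by rw [pow_succ] at hj; omega⟩⟩, ?_⟩
      refine Sigma.ext rfl (heq_of_eq (Fin.ext ?_))
      show j = 2 ^ k + (j - 2 ^ k)
      omega

theorem lower_injective : Function.Injective lower := by
  rintro ⟨k, j, hj⟩ ⟨k', j', hj'⟩ h
  simp only [lower, Sigma.mk.injEq, add_left_inj] at h
  obtain ⟨rfl, h⟩ := h
  simp only [heq_eq_eq, Fin.mk.injEq] at h
  subst h
  rfl

theorem upper_injective : Function.Injective upper := by
  rintro ⟨k, j, hj⟩ ⟨k', j', hj'⟩ h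
  simp only [upper, Sigma.mk.injEq, add_left_inj] at h
  obtain ⟨rfl, h⟩ := h
  simp only [heq_eq_eq, Fin.mk.injEq, add_right_inj] at h
  subst h
  rfl

theorem lower_ne_root (I : DyadicInterval) : lower I ≠ root := fun h => by
  simpa [lower, root] using congrArg Sigma.fst h

theorem upper_ne_root (I : DyadicInterval) : upper I ≠ root := fun h => by
  simpa [upper, root] using congrArg Sigma.fst h

theorem left_lower (I : DyadicInterval) : I.lower.left = I.left.lower := rfl

theorem right_lower (I : DyadicInterval) : I.lower.right = I.right.lower := rfl

theorem left_upper (I : DyadicInterval) : I.upper.left = I.left.upper := by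
  refine Sigma.ext rfl (heq_of_eq (Fin.ext ?_))
  show 2 * (2 ^ I.1 + (I.2 : ℕ)) = 2 ^ (I.1 + 1) + 2 * (I.2 : ℕ)
  ring

theorem right_upper (I : DyadicInterval) : I.upper.right = I.right.upper := by
  refine Sigma.ext rfl (heq_of_eq (Fin.ext ?_))
  show 2 * (2 ^ I.1 + (I.2 : ℕ)) + 1 = 2 ^ (I.1 + 1) + (2 * (I.2 : ℕ) + 1)
  ring

theorem left_root : root.left = root.lower := rfl

theorem right_root : root.right = root.upper := rfl

theorem mem_set_root {x : ℝ} : x ∈ root.set ↔ x ∈ unitInterval := by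
  simp [root, set, unitInterval]

theorem mem_set_lower {I : DyadicInterval} {x : ℝ} : x ∈ I.lower.set ↔ 2 * x ∈ I.set := by
  have h : (0 : ℝ) < 2 ^ I.1 := by positivity
  simp only [lower, set, Set.mem_Ico, pow_succ]
  rw [div_le_iff₀ (by positivity), lt_div_iff₀ (by positivity), div_le_iff₀ h, lt_div_iff₀ h]
  constructor <;> rintro ⟨h1, h2⟩ <;> constructor <;> linarith

theorem mem_set_upper {I : DyadicInterval} {x : ℝ} : x ∈ I.upper.set ↔ 2 * x - 1 ∈ I.set := by
  have h : (0 : ℝ) < 2 ^ I.1 := by positivity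
  simp only [upper, set, Set.mem_Ico, pow_succ]
  rw [div_le_iff₀ (by positivity), lt_div_iff₀ (by positivity), div_le_iff₀ h, lt_div_iff₀ h]
  push_cast
  constructor <;> rintro ⟨h1, h2⟩ <;> constructor <;> linarith

theorem length_pos (I : DyadicInterval) : 0 < I.length := by
  unfold length
  positivity

theorem length_lower (I : DyadicInterval) : I.lower.length = I.length / 2 := by
  simp only [lower, length, pow_succ]
  field_simp

theorem length_upper (I : DyadicInterval) : I.upper.length = I.length / 2 := by
  simp only [upper, length, pow_succ]
  field_simp

theorem set_subset (I : DyadicInterval) : I.set ⊆ unitInterval := by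
  have h : (0 : ℝ) < 2 ^ I.1 := by positivity
  rintro x ⟨h1, h2⟩
  have h3 : ((I.2 : ℕ) : ℝ) + 1 ≤ 2 ^ I.1 := by exact_mod_cast I.2.isLt
  refine ⟨le_trans (by positivity) h1, lt_of_lt_of_le h2 ?_⟩
  rwa [div_le_one h]

theorem measurableSet_set (I : DyadicInterval) : MeasurableSet I.set := measurableSet_Ico

theorem volume_real_set (I : DyadicInterval) : volume.real I.set = I.length := by
  simp only [set, length, Measure.real, Real.volume_Ico]
  rw [← sub_div, add_sub_cancel_left, ENNReal.toReal_ofReal (by positivity), one_div]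

theorem sqrt_length_lower_inv (I : DyadicInterval) :
    (Real.sqrt (I.length / 2))⁻¹ = Real.sqrt 2 * (Real.sqrt I.length)⁻¹ := by
  rw [Real.sqrt_div I.length_pos.le, inv_div, div_eq_mul_inv]

theorem indicator_set_lower (I : DyadicInterval) (x : ℝ) :
    I.lower.set.indicator (1 : ℝ → ℝ) x = I.set.indicator 1 (2 * x) := by
  classical simp [Set.indicator_apply, mem_set_lower]

theorem indicator_set_upper (I : DyadicInterval) (x : ℝ) :
    I.upper.set.indicator (1 : ℝ → ℝ) x = I.set.indicator 1 (2 * x - 1) := by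
  classical simp [Set.indicator_apply, mem_set_upper]

theorem set_root : root.set = unitInterval := Set.ext fun _ => mem_set_root

theorem haar_lower (I : DyadicInterval) (x : ℝ) :
    I.lower.haar x = Real.sqrt 2 * I.haar (2 * x) := by
  simp only [haar, length_lower, sqrt_length_lower_inv, left_lower, right_lower,
    indicator_set_lower, mul_assoc]

theorem haar_upper (I : DyadicInterval) (x : ℝ) :
    I.upper.haar x = Real.sqrt 2 * I.haar (2 * x - 1) := by
  simp only [haar, length_upper, sqrt_length_lower_inv, left_upper, right_upper,
    indicator_set_upper, mul_assoc]

theorem haar_eq_zero (I : DyadicInterval) {x : ℝ} (hx : x ∉ unitInterval) : I.haar x = 0 := by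
  simp only [haar]
  rw [Set.indicator_of_notMem (fun h => hx (I.right.set_subset h)),
    Set.indicator_of_notMem (fun h => hx (I.left.set_subset h)), sub_zero, mul_zero]

theorem haar_root (x : ℝ) : root.haar x =
    unitInterval.indicator 1 (2 * x - 1) - unitInterval.indicator 1 (2 * x) := by
  have : root.length = 1 := by simp [root, length]
  simp only [haar, this, Real.sqrt_one, inv_one, one_mul, left_root, right_root,
    indicator_set_lower, indicator_set_upper, set_root]

theorem integral_haar (I : DyadicInterval) : ∫ x, I.haar x = 0 := by
  have h : ∀ J : DyadicInterval, Integrable (J.set.indicator (1 : ℝ → ℝ)) := fun J =>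
    (integrable_indicator_iff J.measurableSet_set).2
      (integrableOn_const (by simp [set]) : IntegrableOn (fun _ : ℝ => (1 : ℝ)) J.set volume)
  simp only [haar]
  rw [integral_const_mul, integral_sub (h _) (h _), integral_indicator_one (measurableSet_set _),
    integral_indicator_one (measurableSet_set _), volume_real_set, volume_real_set]
  simp [left, right, length]

end DyadicInterval

open DyadicInterval

/-! ### Averages of step functions -/

theorem setIntegral_lower (I : DyadicInterval) (l r : Tree ℝ) :
    ∫ x in I.lower.set, (Tree.node l r).eval x = 1 / 2 * ∫ x in I.set, l.eval x := by
  rw [← integral_indicator (measurableSet_set _), ← integral_indicator (measurableSet_set _),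
    ← smul_eq_mul, ← integral_comp_two_mul]
  refine integral_congr_ae (Filter.Eventually.of_forall fun x => ?_)
  classical
  simp only [Set.indicator_apply, mem_set_lower]
  split_ifs with h
  · have := (I.set_subset h).2
    rw [Tree.eval, if_pos (by linarith)]
  · rfl

theorem setIntegral_upper (I : DyadicInterval) (l r : Tree ℝ) :
    ∫ x in I.upper.set, (Tree.node l r).eval x = 1 / 2 * ∫ x in I.set, r.eval x := by
  rw [← integral_indicator (measurableSet_set _), ← integral_indicator (measurableSet_set _),
    ← smul_eq_mul, ← integral_comp_two_mul_sub_one]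
  refine integral_congr_ae (Filter.Eventually.of_forall fun x => ?_)
  classical
  simp only [Set.indicator_apply, mem_set_upper]
  split_ifs with h
  · have := (I.set_subset h).1
    rw [Tree.eval, if_neg (by linarith)]
  · rfl

/-- A matrix entry as a linear functional. -/
def entry (i j : Fin 2) : Mat →ₗ[ℝ] ℝ where
  toFun A := A i j
  map_add' _ _ := rfl
  map_smul' _ _ := rfl

theorem average_eval_apply (t : Tree Mat) (I : DyadicInterval) (i j : Fin 2) :
    average t.eval I i j = I.length⁻¹ * ∫ x in I.set, (t.map (entry i j)).eval x := by
  simp only [average, Matrix.of_apply, Tree.eval_map]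
  rfl

theorem average_eval_root (t : Tree Mat) : average t.eval root = t.mean := by
  ext i j
  rw [average_eval_apply, set_root, (Tree.integral_eval _).2, Tree.mean_map]
  simp only [root, DyadicInterval.length, pow_zero, inv_one, one_mul]
  rfl

theorem average_eval_lower (l r : Tree Mat) (I : DyadicInterval) :
    average (Tree.node l r).eval I.lower = average l.eval I := by
  ext i j
  rw [average_eval_apply, average_eval_apply, Tree.map, setIntegral_lower, length_lower]
  have := I.length_pos
  field_simp

theorem average_eval_upper (l r : Tree Mat) (I : DyadicInterval) :
    average (Tree.node l r).eval I.upper = average r.eval I := by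
  ext i j
  rw [average_eval_apply, average_eval_apply, Tree.map, setIntegral_upper, length_upper]
  have := I.length_pos
  field_simp

theorem average_eval_leaf (A : Mat) (I : DyadicInterval) :
    average (Tree.leaf A).eval I = A := by
  ext i j
  rw [average_eval_apply]
  simp only [Tree.map, Tree.eval, setIntegral_const, volume_real_set, smul_eq_mul]
  rw [inv_mul_cancel_left₀ I.length_pos.ne']
  rfl

/-- The average of the inverse. -/
def Tree.meanInv (t : Tree Mat) : Mat := (t.map fun A => A⁻¹).mean

/-- The pair of averages of `W` and `W⁻¹` satisfies `P` on every dyadic interval. -/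
def Tree.AllAverages (P : Mat → Mat → Prop) : Tree Mat → Prop
  | .leaf A => P A A⁻¹
  | .node l r => P (Tree.node l r).mean (Tree.node l r).meanInv ∧
      Tree.AllAverages P l ∧ Tree.AllAverages P r

/-- On subintervals of a leaf both averages are constant, so the nodes and leaves of the tree
account for all dyadic intervals. -/
theorem Tree.AllAverages.average {P : Mat → Mat → Prop} : ∀ {t : Tree Mat}, t.AllAverages P →
    ∀ I, P (average t.eval I) (average (t.map fun A => A⁻¹).eval I)
  | .leaf A, h, I => by
    rw [Tree.map, average_eval_leaf, average_eval_leaf]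
    exact h
  | .node l r, h, I => by
    rcases I.eq_root_or with rfl | ⟨J, rfl⟩ | ⟨J, rfl⟩
    · rw [average_eval_root, average_eval_root]
      exact h.1
    · rw [Tree.map, average_eval_lower, average_eval_lower]
      exact h.2.1.average J
    · rw [Tree.map, average_eval_upper, average_eval_upper]
      exact h.2.2.average J

/-! ### Haar coefficients and the Haar shift of step functions -/

/-- The step function on `[0,1)`, extended by zero. -/
def Tree.fn (t : Tree Plane) : ℝ → Plane := unitInterval.indicator t.eval

theorem Tree.fn_node (l r : Tree Plane) (x : ℝ) :
    (Tree.node l r).fn x = l.fn (2 * x) + r.fn (2 * x - 1) :=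
  indicator_unitInterval_halves (fun x _ hx => by simp only [Tree.eval, if_pos hx])
      (fun x hx _ => by simp only [Tree.eval, if_neg (not_lt.2 hx)]) x

theorem Tree.integrable_fn (t : Tree Plane) : Integrable t.fn :=
  (integrable_indicator_iff measurableSet_unitInterval).2 t.integral_eval.1

theorem Tree.integral_fn (t : Tree Plane) : ∫ x, t.fn x = t.mean := by
  rw [Tree.fn, integral_indicator measurableSet_unitInterval, t.integral_eval.2]

theorem not_mem_halves {x : ℝ} (h : 2 * x ∈ unitInterval) : 2 * x - 1 ∉ unitInterval :=
  fun h' => by linarith [h.2, h'.1]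

theorem haarCoeff_leaf (v : Plane) (I : DyadicInterval) :
    haarCoeff (Tree.leaf v).fn I = 0 := by
  have : ∀ x, I.haar x • (Tree.leaf v).fn x = I.haar x • v := fun x => by
    by_cases hx : x ∈ unitInterval
    · rw [Tree.fn, Set.indicator_of_mem hx]
      rfl
    · rw [I.haar_eq_zero hx, zero_smul, zero_smul]
  rw [haarCoeff, integral_congr_ae (Filter.Eventually.of_forall this), integral_smul_const,
    integral_haar, zero_smul]

theorem haarCoeff_node_root (l r : Tree Plane) :
    haarCoeff (Tree.node l r).fn root = (1 / 2 : ℝ) • (r.mean - l.mean) := by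
  have : ∀ x, root.haar x • (Tree.node l r).fn x = r.fn (2 * x - 1) - l.fn (2 * x) := fun x => by
    rw [haar_root, Tree.fn_node]
    by_cases h : 2 * x ∈ unitInterval
    · have h' := not_mem_halves h
      simp [Tree.fn, h, h']
    · by_cases h' : 2 * x - 1 ∈ unitInterval <;> simp [Tree.fn, h, h']
  rw [haarCoeff, integral_congr_ae (Filter.Eventually.of_forall this), integral_sub
    (integrable_comp_two_mul_sub_one r.integrable_fn)
    (l.integrable_fn.comp_mul_left' (R := 2) two_ne_zero), integral_comp_two_mul,
    integral_comp_two_mul_sub_one, r.integral_fn, l.integral_fn, smul_sub]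

/-- The change of variables costs `1/2` and the normalization of the Haar function gains `√2`. The
remaining factor cancels against the `√2` in `haar_lower`, so the recursion for the shift is free of
scale. -/
theorem haarCoeff_node_lower (l r : Tree Plane) (I : DyadicInterval) :
    haarCoeff (Tree.node l r).fn I.lower = (Real.sqrt 2 / 2) • haarCoeff l.fn I := by
  have : ∀ x, I.lower.haar x • (Tree.node l r).fn x =
      Real.sqrt 2 • (fun y => I.haar y • l.fn y) (2 * x) := fun x => by
    simp only [haar_lower, Tree.fn_node, mul_smul]
    by_cases h : 2 * x ∈ unitInterval
    · rw [Tree.fn, Tree.fn, Set.indicator_of_notMem (not_mem_halves h), add_zero]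
    · rw [haar_eq_zero I h, zero_smul, zero_smul]
  rw [haarCoeff, integral_congr_ae (Filter.Eventually.of_forall this), integral_smul,
    integral_comp_two_mul fun y => I.haar y • l.fn y, smul_smul, haarCoeff, mul_one_div]

theorem haarCoeff_node_upper (l r : Tree Plane) (I : DyadicInterval) :
    haarCoeff (Tree.node l r).fn I.upper = (Real.sqrt 2 / 2) • haarCoeff r.fn I := by
  have : ∀ x, I.upper.haar x • (Tree.node l r).fn x =
      Real.sqrt 2 • (fun y => I.haar y • r.fn y) (2 * x - 1) := fun x => by
    simp only [haar_upper, Tree.fn_node, mul_smul]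
    by_cases h : 2 * x ∈ unitInterval
    · rw [haar_eq_zero I (not_mem_halves h), zero_smul, zero_smul]
    · rw [Tree.fn, Tree.fn, Set.indicator_of_notMem h, zero_add]
  rw [haarCoeff, integral_congr_ae (Filter.Eventually.of_forall this), integral_smul,
    integral_comp_two_mul_sub_one fun y => I.haar y • r.fn y, smul_smul, haarCoeff, mul_one_div]

theorem finite_haarCoeff_ne_zero : ∀ t : Tree Plane, {I | haarCoeff t.fn I ≠ 0}.Finite
  | .leaf v => by simp [haarCoeff_leaf]
  | .node l r => by
    refine ((Set.finite_singleton root).union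
      (((finite_haarCoeff_ne_zero l).image lower).union
        ((finite_haarCoeff_ne_zero r).image upper))).subset fun I hI => ?_
    rcases I.eq_root_or with rfl | ⟨J, rfl⟩ | ⟨J, rfl⟩
    · exact Or.inl rfl
    · refine Or.inr (Or.inl ⟨J, fun h => hI ?_, rfl⟩)
      rw [haarCoeff_node_lower, h, smul_zero]
    · refine Or.inr (Or.inr ⟨J, fun h => hI ?_, rfl⟩)
      rw [haarCoeff_node_upper, h, smul_zero]

/-- The Haar function of `[0,1)`, with value `-1` on the left and `1` on the right half. -/
def sgn (x : ℝ) : ℝ := if x < 1 / 2 then -1 else 1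

/-- The jump of the Haar shift that is caused by the Haar coefficient of `[0,1)`, if the averages
on the halves are `u` (left) and `v` (right). -/
def jump (u v : Plane) : Plane := (Real.sqrt 2 / 2) • (v - u)

/-- The Haar shift of a step function. -/
def Tree.shift : Tree Plane → ℝ → Plane
  | .leaf _, _ => 0
  | .node l r, x =>
    if x < 1 / 2 then sgn (2 * x) • -jump l.mean r.mean + Tree.shift l (2 * x)
    else sgn (2 * x - 1) • jump l.mean r.mean + Tree.shift r (2 * x - 1)

theorem stronglyMeasurable_sgn : StronglyMeasurable sgn :=
  StronglyMeasurable.ite (measurableSet_lt measurable_id measurable_const)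
    stronglyMeasurable_const stronglyMeasurable_const

theorem Tree.stronglyMeasurable_shift : ∀ t : Tree Plane, StronglyMeasurable t.shift
  | .leaf _ => stronglyMeasurable_const
  | .node l r => by
    have h₀ : Measurable fun x : ℝ => 2 * x := measurable_const.mul measurable_id
    have h₁ : Measurable fun x : ℝ => 2 * x - 1 := h₀.sub_const 1
    refine StronglyMeasurable.ite (measurableSet_lt measurable_id measurable_const) ?_ ?_
    · exact ((stronglyMeasurable_sgn.comp_measurable h₀).smul_const _).add
        (l.stronglyMeasurable_shift.comp_measurable h₀)
    · exact ((stronglyMeasurable_sgn.comp_measurable h₁).smul_const _).add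
        (r.stronglyMeasurable_shift.comp_measurable h₁)

theorem haar_root_eq_sgn {x : ℝ} (hx : x ∈ unitInterval) : root.haar x = sgn x := by
  obtain ⟨h0, h1⟩ := hx
  rw [haar_root, sgn]
  split_ifs with h
  · rw [Set.indicator_of_notMem (fun h' => by linarith [h'.1]),
      Set.indicator_of_mem (show 2 * x ∈ unitInterval from ⟨by linarith, by linarith⟩)]
    simp
  · rw [Set.indicator_of_notMem (s := unitInterval) (a := 2 * x) (fun h' => by linarith [h'.2]),
      Set.indicator_of_mem (show 2 * x - 1 ∈ unitInterval from ⟨by linarith, by linarith⟩)]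
    simp

theorem hasSum_haarShift : ∀ (t : Tree Plane) {x : ℝ}, x ∈ unitInterval →
    HasSum (fun I : DyadicInterval => (I.right.haar x - I.left.haar x) • haarCoeff t.fn I)
      (t.shift x)
  | .leaf v, x, _ => by
    simp only [haarCoeff_leaf, smul_zero]
    exact hasSum_zero
  | .node l r, x, hx => by
    classical
    set f := fun I : DyadicInterval =>
      (I.right.haar x - I.left.haar x) • haarCoeff (Tree.node l r).fn I with hf
    -- The root term produces the jump. The other terms live in one half each, and only those of the
    -- half containing `x` survive.
    have hsplit : f = fun I => (if I = root then f root else 0) +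
        (if I = root then 0 else f I) := by
      funext I
      by_cases h : I = root
      · simp [h]
      · simp [h]
    have h2 : Real.sqrt 2 * (Real.sqrt 2 / 2) = 1 := by
      rw [← mul_div_assoc, Real.mul_self_sqrt (by norm_num)]
      norm_num
    have hroot : HasSum (fun I => if I = root then f root else 0) (f root) :=
      hasSum_ite_eq root (f root)
    rw [hsplit, Tree.shift]
    have hfr : f root = (root.upper.haar x - root.lower.haar x) •
        (1 / 2 : ℝ) • (r.mean - l.mean) := by
      rw [hf, ← haarCoeff_node_root]
      rfl
    split_ifs with hx2
    · have hm : 2 * x ∈ unitInterval := ⟨by linarith [hx.1], by linarith⟩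
      refine HasSum.add ?_ ?_
      · convert hroot using 1
        rw [hfr, haar_lower, haar_upper, haar_eq_zero _ (not_mem_halves hm), haar_root_eq_sgn hm,
          jump, smul_smul, ← neg_smul, smul_smul]
        congr 1
        ring
      · rw [← lower_injective.hasSum_iff]
        · convert hasSum_haarShift l hm using 1
          funext J
          simp only [Function.comp_apply, lower_ne_root, if_false, hf]
          rw [left_lower, right_lower, haar_lower, haar_lower, haarCoeff_node_lower, ← mul_sub,
            smul_smul, mul_right_comm, h2, one_mul]
        · intro I hI
          rcases I.eq_root_or with rfl | ⟨J, rfl⟩ | ⟨J, rfl⟩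
          · exact if_pos rfl
          · exact absurd ⟨J, rfl⟩ hI
          · simp only [upper_ne_root, if_false, hf]
            rw [left_upper, right_upper, haar_upper, haar_upper, haar_eq_zero _ (not_mem_halves hm),
              haar_eq_zero _ (not_mem_halves hm), sub_self, zero_smul]
    · have hm : 2 * x - 1 ∈ unitInterval := ⟨by linarith, by linarith [hx.2]⟩
      have hm' : 2 * x ∉ unitInterval := fun h => not_mem_halves h hm
      refine HasSum.add ?_ ?_
      · convert hroot using 1
        rw [hfr, haar_lower, haar_upper, haar_eq_zero _ hm', haar_root_eq_sgn hm,
          jump, smul_smul, smul_smul]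
        congr 1
        ring
      · rw [← upper_injective.hasSum_iff]
        · convert hasSum_haarShift r hm using 1
          funext J
          simp only [Function.comp_apply, upper_ne_root, if_false, hf]
          rw [left_upper, right_upper, haar_upper, haar_upper, haarCoeff_node_upper, ← mul_sub,
            smul_smul, mul_right_comm, h2, one_mul]
        · intro I hI
          rcases I.eq_root_or with rfl | ⟨J, rfl⟩ | ⟨J, rfl⟩
          · exact if_pos rfl
          · simp only [lower_ne_root, if_false, hf]
            rw [left_lower, right_lower, haar_lower, haar_lower, haar_eq_zero _ hm',
              haar_eq_zero _ hm', sub_self, zero_smul]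
          · exact absurd ⟨J, rfl⟩ hI

theorem haarShift_fn (t : Tree Plane) {x : ℝ} (hx : x ∈ unitInterval) :
    haarShift t.fn x = t.shift x :=
  (hasSum_haarShift t hx).tsum_eq

/-! ### The action of matrices -/

theorem act_mul (A B : Mat) (x : Plane) : act (A * B) x = act A (act B x) := by
  simp only [act, Matrix.mulVec_mulVec]

theorem act_one (x : Plane) : act 1 x = x := by simp [act]

/-- Evaluation at a vector is linear in the matrix. -/
def actL (e : Plane) : Mat →ₗ[ℝ] Plane where
  toFun A := act A e
  map_add' A B := by simp only [act, Matrix.add_mulVec, WithLp.toLp_add]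
  map_smul' c A := by
    simp only [act, Matrix.smul_mulVec, WithLp.toLp_smul, RingHom.id_apply]

/-- The quadratic form of a matrix. -/
def quad (A : Mat) (g : Plane) : ℝ := inner ℝ (act A g) g

theorem quad_eq_dotProduct (A : Mat) (g : Plane) :
    quad A g = dotProduct g.ofLp (A.mulVec g.ofLp) := by
  simp [quad, act, EuclideanSpace.inner_eq_star_dotProduct]

theorem quad_nonneg {A : Mat} (hA : A.PosDef) (g : Plane) : 0 ≤ quad A g := by
  rw [quad_eq_dotProduct]
  simpa using hA.posSemidef.dotProduct_mulVec_nonneg g.ofLp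

/-! ### The energy of the Haar shift -/

namespace Tree

/-- The step function `W⁻¹ e`. -/
def test (t : Tree Mat) (e : Plane) : Tree Plane := t.map fun A => act A⁻¹ e

theorem test_mean (t : Tree Mat) (e : Plane) : (t.test e).mean = act t.meanInv e := by
  have : t.test e = (t.map fun A => A⁻¹).map (actL e) := by
    rw [map_map]
    rfl
  rw [this, mean_map]
  rfl

/-- The integral of `(W g, g)` over `[0,1)`, where `g = G + sgn • P + Ш (W⁻¹ e)`. -/
def energy (e : Plane) : Tree Mat → Plane → Plane → ℝ
  | leaf A, G, P => 1 / 2 * (quad A (G - P) + quad A (G + P))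
  | node l r, G, P =>
    1 / 2 * (energy e l (G - P) (-jump (act l.meanInv e) (act r.meanInv e)) +
      energy e r (G + P) (jump (act l.meanInv e) (act r.meanInv e)))

theorem energy_nonneg (e : Plane) : ∀ {t : Tree Mat}, t.All Matrix.PosDef →
    ∀ G P, 0 ≤ energy e t G P
  | leaf A, h, G, P => by
    have h1 := quad_nonneg h (G - P)
    have h2 := quad_nonneg h (G + P)
    rw [energy]
    positivity
  | node l r, h, G, P => by
    have h1 := energy_nonneg e h.1 (G - P) (-jump (act l.meanInv e) (act r.meanInv e))
    have h2 := energy_nonneg e h.2 (G + P) (jump (act l.meanInv e) (act r.meanInv e))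
    rw [energy]
    positivity

/-- The form `G + sgn • P + shift` reproduces itself: on the halves `sgn • P` becomes the constant
`∓P`, and the coefficient of the interval becomes the new Haar term `∓jump`. -/
theorem integral_quad (e : Plane) : ∀ (t : Tree Mat) (G P : Plane),
    IntegrableOn (fun x => quad (t.eval x) (G + sgn x • P + (t.test e).shift x)) unitInterval ∧
      ∫ x in unitInterval, quad (t.eval x) (G + sgn x • P + (t.test e).shift x) = energy e t G P
  | leaf A, G, P => by
    have := integral_unitInterval_halves
      (h := fun x => quad ((leaf A).eval x) (G + sgn x • P + ((leaf A).test e).shift x))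
      (hl := fun _ => quad A (G - P)) (hr := fun _ => quad A (G + P))
      (fun x _ hx => by
        have h : sgn x = -1 := if_pos hx
        simp [eval, test, map, shift, h, sub_eq_add_neg])
      (fun x hx _ => by
        have h : sgn x = 1 := if_neg (not_lt.2 hx)
        simp [eval, test, map, shift, h])
      (integrableOn_const_unitInterval _) (integrableOn_const_unitInterval _)
    rwa [integral_const_unitInterval, integral_const_unitInterval] at this
  | node l r, G, P => by
    obtain ⟨il, hl⟩ := integral_quad e l (G - P) (-jump (act l.meanInv e) (act r.meanInv e))
    obtain ⟨ir, hr⟩ := integral_quad e r (G + P) (jump (act l.meanInv e) (act r.meanInv e))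
    have := integral_unitInterval_halves
      (h := fun x => quad ((node l r).eval x) (G + sgn x • P + ((node l r).test e).shift x))
      (fun x _ hx => ?_) (fun x hx _ => ?_) il ir
    · rwa [hl, hr] at this
    · have h1 : ((node l r).test e).shift x =
          sgn (2 * x) • -jump (act l.meanInv e) (act r.meanInv e) + (l.test e).shift (2 * x) := by
        rw [← test_mean, ← test_mean]
        exact if_pos hx
      have h2 : sgn x = -1 := if_pos hx
      have h3 : (node l r).eval x = l.eval (2 * x) := if_pos hx
      simp only [h1, h2, h3, neg_one_smul, ← sub_eq_add_neg, add_assoc]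
    · have h1 : ((node l r).test e).shift x = sgn (2 * x - 1) •
          jump (act l.meanInv e) (act r.meanInv e) + (r.test e).shift (2 * x - 1) := by
        rw [← test_mean, ← test_mean]
        exact if_neg (not_lt.2 hx)
      have h2 : sgn x = 1 := if_neg (not_lt.2 hx)
      have h3 : (node l r).eval x = r.eval (2 * x - 1) := if_neg (not_lt.2 hx)
      simp only [h1, h2, h3, one_smul, add_assoc]

/-! ### Matrix weights given by trees -/

theorem isMatrixWeight {t : Tree Mat} (h : t.All Matrix.PosDef) : IsMatrixWeight t.eval := by
  refine ⟨fun x _ => (h.eval x).posSemidef, fun i j => ?_⟩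
  have := (t.map (entry i j)).integral_eval.1
  have h' : (t.map (entry i j)).eval = fun x => t.eval x i j := funext fun x => eval_map _ t x
  rwa [h'] at this

theorem All.inv : ∀ {t : Tree Mat}, t.All Matrix.PosDef → (t.map fun A => A⁻¹).All Matrix.PosDef
  | leaf _, h => Matrix.PosDef.inv h
  | node _ _, h => ⟨All.inv h.1, All.inv h.2⟩

theorem testFunction_eval (t : Tree Mat) (e : Plane) :
    testFunction t.eval e = (t.test e).fn := by
  rw [testFunction, fn]
  congr 1
  funext x
  rw [test, eval_map]

/-- Since `W f = e`, the density `(W f, f)` is `(e, W⁻¹ e)`, which is linear in `W⁻¹`; hence the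
norm depends only on the average of `W⁻¹`. -/
theorem quad_testFunction {t : Tree Mat} (h : t.All Matrix.PosDef) (e : Plane) {x : ℝ}
    (hx : x ∈ unitInterval) : quad (t.eval x) (testFunction t.eval e x) =
      (t.map fun A => inner ℝ e (act A⁻¹ e)).eval x := by
  have := (h.eval x).isUnit
  rw [testFunction, Set.indicator_of_mem hx, eval_map, quad, ← act_mul,
    Matrix.mul_nonsing_inv _ ((Matrix.isUnit_iff_isUnit_det _).1 this), act_one]

theorem mean_inner (t : Tree Mat) (e : Plane) :
    (t.map fun A => inner ℝ e (act A⁻¹ e)).mean = inner ℝ e (act t.meanInv e) := by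
  have : (t.map fun A => inner ℝ e (act A⁻¹ e)) = (t.test e).map (innerₛₗ ℝ e) := by
    rw [test, map_map]
    rfl
  rw [this, mean_map, test_mean]
  rfl

theorem memL2_testFunction {t : Tree Mat} (h : t.All Matrix.PosDef) (e : Plane) :
    MemL2 t.eval (testFunction t.eval e) := by
  constructor
  · rw [testFunction_eval]
    exact ((t.test e).stronglyMeasurable_eval.indicator
      measurableSet_unitInterval).aestronglyMeasurable
  · exact (t.map fun A => inner ℝ e (act A⁻¹ e)).integral_eval.1.congr_fun
      (fun x hx => (quad_testFunction h e hx).symm) measurableSet_unitInterval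

theorem normL2_testFunction {t : Tree Mat} (h : t.All Matrix.PosDef) (e : Plane) :
    normL2 t.eval (testFunction t.eval e) = Real.sqrt (inner ℝ e (act t.meanInv e)) := by
  rw [normL2, ← mean_inner, ← integral_eval _ |>.2]
  congr 1
  exact setIntegral_congr_fun measurableSet_unitInterval fun x hx => quad_testFunction h e hx

theorem quad_haarShift (t : Tree Mat) (e : Plane) {x : ℝ} (hx : x ∈ unitInterval) :
    quad (t.eval x) (haarShift (testFunction t.eval e) x) =
      quad (t.eval x) (0 + sgn x • (0 : Plane) + (t.test e).shift x) := by
  rw [testFunction_eval, haarShift_fn _ hx, smul_zero, zero_add, zero_add]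

theorem memL2_haarShift (t : Tree Mat) (e : Plane) :
    MemL2 t.eval (haarShift (testFunction t.eval e)) := by
  constructor
  · refine (t.test e).stronglyMeasurable_shift.aestronglyMeasurable.congr ?_
    refine (ae_restrict_iff' measurableSet_unitInterval).2 (Filter.Eventually.of_forall ?_)
    intro x hx
    rw [testFunction_eval, haarShift_fn _ hx]
  · exact (integral_quad e t 0 0).1.congr_fun
      (fun x hx => (quad_haarShift t e hx).symm) measurableSet_unitInterval

theorem normL2_haarShift (t : Tree Mat) (e : Plane) :
    normL2 t.eval (haarShift (testFunction t.eval e)) = Real.sqrt (energy e t 0 0) := by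
  rw [normL2, ← (integral_quad e t 0 0).2]
  congr 1
  exact setIntegral_congr_fun measurableSet_unitInterval fun x hx => quad_haarShift t e hx

end Tree

/-! ### Matrices with given eigenvectors -/

/-- `a`, `b` is an orthonormal basis of the plane. -/
structure Axes (a b : Plane) : Prop where
  aa : inner ℝ a a = (1 : ℝ)
  bb : inner ℝ b b = (1 : ℝ)
  ab : inner ℝ a b = (0 : ℝ)

theorem inner_eq_dotProduct (x y : Plane) : inner ℝ x y = x.ofLp ⬝ᵥ y.ofLp := by
  rw [EuclideanSpace.inner_eq_star_dotProduct, star_trivial, dotProduct_comm]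

theorem act_diagMat (a b : Plane) (x y : ℝ) (g : Plane) :
    act (diagMat a b x y) g = (x * inner ℝ a g) • a + (y * inner ℝ b g) • b := by
  ext i
  fin_cases i <;>
  simp [act, diagMat, dotProduct, Matrix.vecMulVec, Fin.sum_univ_two,
    EuclideanSpace.inner_eq_star_dotProduct] <;> ring

theorem quad_diagMat (a b : Plane) (x y : ℝ) (g : Plane) :
    quad (diagMat a b x y) g = x * inner ℝ a g ^ 2 + y * inner ℝ b g ^ 2 := by
  rw [quad, act_diagMat, inner_add_left, real_inner_smul_left, real_inner_smul_left]
  ring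

namespace Axes

variable {a b : Plane}

theorem ba (h : Axes a b) : inner ℝ b a = (0 : ℝ) := by rw [real_inner_comm, h.ab]

theorem diagMat_one (h : Axes a b) : diagMat a b 1 1 = 1 := by
  have h1 : a 0 * a 0 + a 1 * a 1 = 1 := by
    simpa [inner_eq_dotProduct, dotProduct, -inner_self_eq_norm_sq_to_K] using h.aa
  have h2 : b 0 * b 0 + b 1 * b 1 = 1 := by
    simpa [inner_eq_dotProduct, dotProduct, -inner_self_eq_norm_sq_to_K] using h.bb
  have h3 : a 0 * b 0 + a 1 * b 1 = 0 := by
    simpa [inner_eq_dotProduct, dotProduct] using h.ab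
  have hM : (Matrix.of ![![a 0, a 1], ![b 0, b 1]] : Mat) *
      Matrix.of ![![a 0, b 0], ![a 1, b 1]] = 1 := by
    ext i j
    fin_cases i <;> fin_cases j <;>
      simp [Matrix.mul_apply, Fin.sum_univ_two] <;> linarith
  -- Orthonormality of the rows gives that of the columns.
  have hM' := mul_eq_one_comm.1 hM
  rw [← hM']
  ext i j
  fin_cases i <;> fin_cases j <;>
    simp [Matrix.mul_apply, Fin.sum_univ_two, diagMat, Matrix.vecMulVec]

theorem diagMat_mul (h : Axes a b) (x y x' y' : ℝ) :
    diagMat a b x y * diagMat a b x' y' = diagMat a b (x * x') (y * y') := by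
  have h1 : a.ofLp ⬝ᵥ a.ofLp = 1 := by
    rw [← inner_eq_dotProduct, h.aa]
  have h2 : b.ofLp ⬝ᵥ b.ofLp = 1 := by
    rw [← inner_eq_dotProduct, h.bb]
  have h3 : a.ofLp ⬝ᵥ b.ofLp = 0 := by
    rw [← inner_eq_dotProduct, h.ab]
  have h4 : b.ofLp ⬝ᵥ a.ofLp = 0 := by rw [dotProduct_comm, h3]
  simp [diagMat, add_mul, mul_add, Matrix.vecMulVec_mul_vecMulVec, h1, h2, h3, h4, smul_smul, mul_comm]

theorem diagMat_self (h : Axes a b) (x : ℝ) : diagMat a b x x = x • (1 : Mat) := by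
  rw [← h.diagMat_one]
  simp [diagMat]

theorem diagMat_inv (h : Axes a b) {x y : ℝ} (hx : 0 < x) (hy : 0 < y) :
    (diagMat a b x y)⁻¹ = diagMat a b x⁻¹ y⁻¹ := by
  refine Matrix.inv_eq_right_inv ?_
  rw [h.diagMat_mul, mul_inv_cancel₀ hx.ne', mul_inv_cancel₀ hy.ne', h.diagMat_one]

theorem posSemidef (a b : Plane) {x y : ℝ} (hx : 0 ≤ x) (hy : 0 ≤ y) :
    (diagMat a b x y).PosSemidef := by
  have := fun v : Plane => Matrix.posSemidef_vecMulVec_self_star (R := ℝ) v.ofLp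
  simp only [star_trivial] at this
  exact ((this a).smul hx).add ((this b).smul hy)

theorem posDef (h : Axes a b) {x y : ℝ} (hx : 0 < x) (hy : 0 < y) :
    (diagMat a b x y).PosDef := by
  rw [Matrix.PosSemidef.posDef_iff_isUnit (posSemidef a b hx.le hy.le)]
  refine IsUnit.of_mul_eq_one (diagMat a b x⁻¹ y⁻¹) ?_
  rw [h.diagMat_mul, mul_inv_cancel₀ hx.ne', mul_inv_cancel₀ hy.ne', h.diagMat_one]

open scoped MatrixOrder in
theorem sqrtMat_diagMat (h : Axes a b) {x y : ℝ} (hx : 0 ≤ x) (hy : 0 ≤ y) :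
    sqrtMat (diagMat a b x y) = diagMat a b (Real.sqrt x) (Real.sqrt y) := by
  refine CFC.sqrt_unique ?_ ?_
  · rw [h.diagMat_mul, Real.mul_self_sqrt hx, Real.mul_self_sqrt hy]
  · exact (posSemidef a b (Real.sqrt_nonneg x) (Real.sqrt_nonneg y)).nonneg

/-- With common axes and equal products of eigenvalues, the product of the square roots is the
scalar matrix `√K`. -/
theorem opNorm_sq (h : Axes a b) {x y x' y' K : ℝ} (hx : 0 ≤ x) (hy : 0 ≤ y) (hx' : 0 ≤ x')
    (hy' : 0 ≤ y') (hK : x * x' = K) (hK' : y * y' = K) :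
    opNorm (sqrtMat (diagMat a b x y) * sqrtMat (diagMat a b x' y')) ^ 2 = K := by
  rw [h.sqrtMat_diagMat hx hy, h.sqrtMat_diagMat hx' hy', h.diagMat_mul, ← Real.sqrt_mul hx,
    ← Real.sqrt_mul hy, hK, hK', h.diagMat_self, opNorm, map_smul, map_one, norm_smul, norm_one,
    mul_one, Real.norm_eq_abs, sq_abs, Real.sq_sqrt]
  rw [← hK]
  positivity

theorem inner_self (h : Axes a b) (g : Plane) :
    inner ℝ g g = inner ℝ a g ^ 2 + inner ℝ b g ^ 2 := by
  have := quad_diagMat a b 1 1 g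
  rwa [h.diagMat_one, quad, act_one, one_mul, one_mul] at this

end Axes

/-! ### Rotated axes -/

/-- The normalizing factor `(1+δ²)^{-1/2}` of a rotation. -/
def lam (δ : ℝ) : ℝ := (Real.sqrt (1 + δ ^ 2))⁻¹

theorem lam_neg (δ : ℝ) : lam (-δ) = lam δ := by rw [lam, lam, neg_sq]

theorem lam_pos (δ : ℝ) : 0 < lam δ := by
  unfold lam
  positivity

theorem lam_sq (δ : ℝ) : lam δ ^ 2 * (1 + δ ^ 2) = 1 := by
  have : 0 < 1 + δ ^ 2 := by positivity
  rw [lam, inv_pow, Real.sq_sqrt this.le, inv_mul_cancel₀ this.ne']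

theorem inner_turn (δ : ℝ) (u v g : Plane) :
    inner ℝ (turn δ u v) g = lam δ * (inner ℝ u g + δ * inner ℝ v g) := by
  rw [turn, real_inner_smul_left, inner_add_left, real_inner_smul_left, lam]

theorem Axes.turn {a b : Plane} (h : Axes a b) (δ : ℝ) :
    Axes (turn δ a b) (HaarLower.turn (-δ) b a) := by
  have h1 := lam_sq δ
  constructor
  · rw [inner_turn, real_inner_comm, inner_turn, real_inner_comm (HaarLower.turn δ a b) b,
      inner_turn, real_inner_comm b a, h.aa, h.bb, h.ba]
    linear_combination h1
  · rw [inner_turn, real_inner_comm, inner_turn,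
      real_inner_comm (HaarLower.turn (-δ) b a) a, inner_turn, real_inner_comm b a, h.aa, h.bb,
      h.ba, lam_neg]
    linear_combination h1
  · rw [inner_turn, real_inner_comm, inner_turn,
      real_inner_comm (HaarLower.turn (-δ) b a) b, inner_turn, real_inner_comm b a, h.aa, h.bb,
      h.ba, lam_neg]
    ring

theorem Axes.turn_neg {a b : Plane} (h : Axes a b) (δ : ℝ) :
    Axes (HaarLower.turn (-δ) a b) (HaarLower.turn δ b a) := by
  simpa using h.turn (-δ)

theorem diagMat_add_diagMat (a b : Plane) (x y x' y' : ℝ) :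
    (1 / 2 : ℝ) • (diagMat a b x y + diagMat a b x' y') =
      diagMat a b ((x + x') / 2) ((y + y') / 2) := by
  ext i j
  simp only [diagMat, Matrix.add_apply, Matrix.smul_apply, Matrix.vecMulVec_apply, smul_eq_mul]
  ring

/-- The mixed terms are odd in `δ` and cancel between the two rotations. -/
theorem diagMat_turn_add (a b : Plane) (δ x y : ℝ) :
    (1 / 2 : ℝ) • (diagMat (turn (-δ) a b) (turn δ b a) x y +
      diagMat (turn δ a b) (turn (-δ) b a) x y) =
      diagMat a b (lam δ ^ 2 * (x + δ ^ 2 * y)) (lam δ ^ 2 * (y + δ ^ 2 * x)) := by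
  ext i j
  simp only [diagMat, Matrix.add_apply, Matrix.smul_apply, Matrix.vecMulVec_apply, smul_eq_mul,
    turn, PiLp.smul_apply, PiLp.add_apply, neg_sq]
  rw [← lam]
  ring

/-! ### The eigenvalues -/

theorem stretch_bounds {Q : ℝ} (hQ : 10 ≤ Q) : 19 / 10 ≤ stretch Q ∧ stretch Q < 2 := by
  have h1 : 1 / Q ≤ 1 / 10 := one_div_le_one_div_of_le (by norm_num) hQ
  have h2 : 0 < 1 / Q := by positivity
  unfold stretch
  constructor <;> linarith

namespace Eig

/-- The invariants of the eigenvalues on stopping intervals; `D` is the determinant of the average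
of `W⁻¹`. -/
structure Valid (Q D : ℝ) (p : Eig) : Prop where
  al_pos : 0 < p.al
  be_pos : 0 < p.be
  be_le : p.be ≤ p.al
  det : p.al * p.be = D
  alS : p.alS = Q * p.al / D
  beS : p.beS = Q * p.be / D

/-- The conditions on the eigenvalues under which one can stop. -/
structure Stoppable (K : ℝ) (p : Eig) : Prop where
  al_pos : 0 < p.al
  be_pos : 0 < p.be
  alS_pos : 0 < p.alS
  beS_pos : 0 < p.beS
  one_le : 1 ≤ K
  al_beS : p.al * p.beS = K
  be_alS : p.be * p.alS = K

namespace Valid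

variable {Q D : ℝ} {p : Eig}

theorem det_pos (h : p.Valid Q D) : 0 < D := h.det ▸ mul_pos h.al_pos h.be_pos

theorem stoppable (h : p.Valid Q D) (hQ : 10 ≤ Q) : p.Stoppable Q := by
  have hD := h.det_pos
  have h1 := h.al_pos
  have h2 := h.be_pos
  refine ⟨h1, h2, ?_, ?_, by linarith, ?_, ?_⟩
  · rw [h.alS]; positivity
  · rw [h.beS]; positivity
  · rw [h.beS, ← h.det]; field_simp
  · rw [h.alS, ← h.det]; field_simp

theorem delta_pos (h : p.Valid Q D) : 0 < p.delta := by
  have h1 := h.al_pos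
  have h2 := h.be_pos
  unfold delta q
  positivity

theorem delta_sq (h : p.Valid Q D) : p.delta ^ 2 = p.be / (100 * p.al) := by
  have h1 := h.al_pos
  have h2 := h.be_pos
  rw [delta, mul_pow, Real.sq_sqrt (by positivity), q]
  field_simp
  norm_num

theorem delta_sq_le (h : p.Valid Q D) : p.delta ^ 2 ≤ 1 / 100 := by
  have h1 := h.al_pos
  rw [h.delta_sq, div_le_div_iff₀ (by positivity) (by norm_num)]
  linarith [h.be_le]

/-- From `δ = q (β/α)^{1/2}` one gets `α δ = q (αβ)^{1/2}`, which depends on the determinant alone.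
This is why the drift is the same in each generation. -/
theorem al_mul_delta_sq (h : p.Valid Q D) : (p.al * p.delta) ^ 2 = D / 100 := by
  have h1 := h.al_pos
  rw [mul_pow, h.delta_sq, ← h.det]
  field_simp

theorem rotated_al_eq (h : p.Valid Q D) :
    p.rotated.al = (100 * p.al ^ 2 - p.be ^ 2) / (100 * p.al - p.be) := by
  have h1 := h.al_pos
  have h2 : 0 < 100 * p.al - p.be := by linarith [h.be_le]
  have h3 : 1 - p.be / (100 * p.al) = (100 * p.al - p.be) / (100 * p.al) := by field_simp
  simp only [rotated]
  rw [h.delta_sq, h3]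
  field_simp

theorem rotated_be_eq (h : p.Valid Q D) :
    p.rotated.be = 99 * p.al * p.be / (100 * p.al - p.be) := by
  have h1 := h.al_pos
  have h2 : 0 < 100 * p.al - p.be := by linarith [h.be_le]
  have h3 : 1 - p.be / (100 * p.al) = (100 * p.al - p.be) / (100 * p.al) := by field_simp
  simp only [rotated]
  rw [h.delta_sq, h3]
  field_simp
  ring

theorem rotated_alS (h : p.Valid Q D) : p.rotated.alS = Q * p.rotated.al / D := by
  simp only [rotated]
  rw [h.alS, h.beS]
  ring

theorem rotated_beS (h : p.Valid Q D) : p.rotated.beS = Q * p.rotated.be / D := by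
  simp only [rotated]
  rw [h.alS, h.beS]
  ring

theorem le_rotated_al (h : p.Valid Q D) : p.al ≤ p.rotated.al := by
  have h1 := h.al_pos
  have h2 : 0 < 100 * p.al - p.be := by linarith [h.be_le]
  rw [h.rotated_al_eq, le_div_iff₀ h2]
  nlinarith [h.be_le, h.be_pos]

theorem rotated_al_le (h : p.Valid Q D) : p.rotated.al ≤ 2 * p.al := by
  have h1 := h.al_pos
  have h2 : 0 < 100 * p.al - p.be := by linarith [h.be_le]
  rw [h.rotated_al_eq, div_le_iff₀ h2]
  nlinarith [h.be_le, h.be_pos]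

theorem rotated_al_pos (h : p.Valid Q D) : 0 < p.rotated.al :=
  h.al_pos.trans_le h.le_rotated_al

theorem rotated_be_pos (h : p.Valid Q D) : 0 < p.rotated.be := by
  have h1 := h.al_pos
  have h3 := h.be_pos
  have h2 : 0 < 100 * p.al - p.be := by linarith [h.be_le]
  rw [h.rotated_be_eq]
  positivity

theorem rotated_be_le (h : p.Valid Q D) : p.rotated.be ≤ p.be := by
  have h1 := h.al_pos
  have h2 : 0 < 100 * p.al - p.be := by linarith [h.be_le]
  rw [h.rotated_be_eq, div_le_iff₀ h2]
  nlinarith [h.be_le, h.be_pos]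

/-- The rotated eigenvalues are the solution of the linear system expressing that the two rotated
matrices average to the original one. -/
theorem mean_al (h : p.Valid Q D) :
    lam p.delta ^ 2 * (p.rotated.al + p.delta ^ 2 * p.rotated.be) = p.al := by
  have h1 := lam_sq p.delta
  have h2 : 1 - p.delta ^ 2 ≠ 0 := by linarith [h.delta_sq_le]
  have h3 : p.rotated.al + p.delta ^ 2 * p.rotated.be = (1 + p.delta ^ 2) * p.al := by
    simp only [rotated]
    field_simp
    ring
  rw [h3]
  linear_combination p.al * h1

theorem mean_be (h : p.Valid Q D) :
    lam p.delta ^ 2 * (p.rotated.be + p.delta ^ 2 * p.rotated.al) = p.be := by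
  have h1 := lam_sq p.delta
  have h2 : 1 - p.delta ^ 2 ≠ 0 := by linarith [h.delta_sq_le]
  have h3 : p.rotated.be + p.delta ^ 2 * p.rotated.al = (1 + p.delta ^ 2) * p.be := by
    simp only [rotated]
    field_simp
    ring
  rw [h3]
  linear_combination p.be * h1

theorem mean_alS (h : p.Valid Q D) :
    lam p.delta ^ 2 * (p.rotated.alS + p.delta ^ 2 * p.rotated.beS) = p.alS := by
  rw [h.rotated_alS, h.rotated_beS, h.alS]
  linear_combination Q / D * h.mean_al

theorem mean_beS (h : p.Valid Q D) :
    lam p.delta ^ 2 * (p.rotated.beS + p.delta ^ 2 * p.rotated.alS) = p.beS := by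
  rw [h.rotated_alS, h.rotated_beS, h.beS]
  linear_combination Q / D * h.mean_be

theorem ratio_eq (h : p.Valid Q D) (hQ : 10 ≤ Q) :
    p.ratio Q = p.rotated.al * p.rotated.be / D := by
  rw [ratio, h.rotated_beS]
  field_simp

/-- With `t = β/α` one finds `1 - s = 100 (1-t)² / (100-t)²`, which vanishes at `t = 1` and is at
most `1/100` on `[0,1]`. -/
theorem ratio_bounds (h : p.Valid Q D) (hQ : 10 ≤ Q) :
    98 / 100 ≤ p.ratio Q ∧ p.ratio Q ≤ 1 := by
  have h1 := h.al_pos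
  have h3 := h.be_pos
  have h4 := h.be_le
  have h2 : 0 < 100 * p.al - p.be := by linarith
  have e : p.ratio Q = 99 * (100 * p.al ^ 2 - p.be ^ 2) / (100 * p.al - p.be) ^ 2 := by
    rw [h.ratio_eq hQ, h.rotated_al_eq, h.rotated_be_eq, ← h.det]
    field_simp
  rw [e, le_div_iff₀ (by positivity), div_le_one (by positivity)]
  constructor <;> nlinarith [mul_pos h1 h3, mul_nonneg h1.le (sub_nonneg.2 h4),
    mul_nonneg h3.le (sub_nonneg.2 h4), sq_nonneg (p.al - p.be)]

theorem ratio_stretch_bounds (h : p.Valid Q D) (hQ : 10 ≤ Q) :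
    9 / 5 ≤ p.ratio Q * stretch Q ∧ p.ratio Q * stretch Q ≤ 2 := by
  obtain ⟨h1, h2⟩ := h.ratio_bounds hQ
  obtain ⟨h3, h4⟩ := stretch_bounds hQ
  constructor <;> nlinarith

theorem next_be (h : p.Valid Q D) (hQ : 10 ≤ Q) :
    (p.next Q).be = D / (stretch Q * p.rotated.al) := by
  have h1 := h.rotated_al_pos
  have h2 := h.rotated_be_pos
  have h3 := h.det_pos
  have h4 := (stretch_bounds hQ).1
  simp only [next]
  rw [h.ratio_eq hQ]
  field_simp

/-- Rotation multiplies the determinant by `s`; the division by `s` in the stretching restores `D`.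
-/
theorem next (h : p.Valid Q D) (hQ : 10 ≤ Q) : (p.next Q).Valid Q D := by
  have h1 := h.rotated_al_pos
  have h2 := h.rotated_be_pos
  have h3 := h.det_pos
  have h4 := (stretch_bounds hQ).1
  have h5 : (p.next Q).al = stretch Q * p.rotated.al := rfl
  have h6 : 0 < (p.next Q).al := by rw [h5]; positivity
  have h7 := h.le_rotated_al
  refine ⟨h6, ?_, ?_, ?_, ?_, ?_⟩
  · rw [h.next_be hQ]; positivity
  · rw [h.next_be hQ, ← h5, div_le_iff₀ h6, ← h.det]
    have h8 : p.al ≤ (p.next Q).al := by rw [h5]; nlinarith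
    exact mul_le_mul h8 (h.be_le.trans h8) h.be_pos.le h6.le
  · rw [h.next_be hQ, ← h5]
    field_simp
  · simp only [Eig.next]
    rw [h.rotated_alS]
    ring
  · simp only [Eig.next]
    rw [h.rotated_beS]
    ring

/-- `α δ` is constant while `α` grows by at least `19/10`, and `10/19 ≤ 3/5`. The geometric decay
keeps the accumulated rotation bounded. -/
theorem next_delta_le (h : p.Valid Q D) (hQ : 10 ≤ Q) :
    (p.next Q).delta ≤ 3 / 5 * p.delta := by
  have h1 := h.rotated_al_pos
  have h3 := h.det_pos
  have h4 := (stretch_bounds hQ).1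
  have h7 := h.le_rotated_al
  have h8 := h.al_pos
  have hn := h.next hQ
  have h5 : (p.next Q).al = stretch Q * p.rotated.al := rfl
  refine le_of_sq_le_sq ?_ (by have := h.delta_pos; positivity)
  have h6 : 19 / 10 * p.al ≤ (p.next Q).al := by rw [h5]; nlinarith
  have e1 := hn.al_mul_delta_sq
  have e2 := h.al_mul_delta_sq
  have h9 : (19 / 10 * p.al) ^ 2 * (p.next Q).delta ^ 2 ≤ (p.al * p.delta) ^ 2 := by
    rw [e2, ← e1, mul_pow (p.next Q).al]
    gcongr
  have h10 : 0 < p.al ^ 2 := by positivity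
  have h11 : p.al ^ 2 * ((19 / 10) ^ 2 * (p.next Q).delta ^ 2) ≤ p.al ^ 2 * p.delta ^ 2 := by
    nlinarith
  have h12 := le_of_mul_le_mul_left h11 h10
  nlinarith [sq_nonneg p.delta]

/-- The small factor `2 - r = 1/Q` cancels the `Q` in the product of the averages, leaving `K = 2s -
1/r`, a number between `1` and `2`. -/
theorem terminal_stoppable (h : p.Valid Q D) (hQ : 10 ≤ Q) :
    (p.terminal Q).Stoppable (2 * p.ratio Q - 1 / stretch Q) := by
  have h1 := h.rotated_al_pos
  have h2 := h.rotated_be_pos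
  have h3 := h.det_pos
  obtain ⟨h4, h5⟩ := stretch_bounds hQ
  obtain ⟨h6, h7⟩ := h.ratio_stretch_bounds hQ
  obtain ⟨h8, h9⟩ := h.ratio_bounds hQ
  have h10 : 2 - stretch Q = 1 / Q := by rw [stretch]; ring
  have h11 : 1 / (p.ratio Q * stretch Q) ≤ 1 := by
    rw [div_le_one (by linarith)]; linarith
  have h12 : 0 < 2 - 1 / (p.ratio Q * stretch Q) := by linarith
  have h13 : 1 / stretch Q ≤ 1 / (19 / 10) := one_div_le_one_div_of_le (by norm_num) h4
  have hs : p.rotated.al * p.rotated.be = p.ratio Q * D := by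
    rw [h.ratio_eq hQ]; field_simp
  have hr0 : p.ratio Q ≠ 0 := by linarith
  have hS0 : stretch Q ≠ 0 := by linarith
  have hK : (1 / Q) * (2 - 1 / (p.ratio Q * stretch Q)) *
      (Q * (p.rotated.al * p.rotated.be) / D) = 2 * p.ratio Q - 1 / stretch Q := by
    rw [hs]; field_simp
  constructor <;> simp -failIfUnchanged only [Eig.terminal]
  · rw [h10]; positivity
  · positivity
  · rw [h10, h.rotated_alS]; positivity
  · rw [h.rotated_beS]; positivity
  · linarith
  · rw [h10, h.rotated_beS, ← hK]; ring
  · rw [h10, h.rotated_alS, ← hK]; ring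

theorem terminal_le_two (h : p.Valid Q D) (hQ : 10 ≤ Q) :
    2 * p.ratio Q - 1 / stretch Q ≤ 2 := by
  have h1 : 0 < 1 / stretch Q := by
    have := (stretch_bounds hQ).1
    positivity
  linarith [(h.ratio_bounds hQ).2]

theorem terminal_alS (h : p.Valid Q D) (hQ : 10 ≤ Q) :
    (p.terminal Q).alS = p.rotated.al / D := by
  have h10 : 2 - stretch Q = 1 / Q := by rw [stretch]; ring
  simp only [Eig.terminal]
  rw [h10, h.rotated_alS]
  field_simp

end Valid

/-! ### The initial eigenvalues. -/

theorem initial_valid {Q δ₀ α₀ : ℝ} (hδ : 0 < δ₀) (hδ' : δ₀ ≤ 1 / 10) (hα : 0 < α₀) :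
    (initial Q δ₀ α₀).Valid Q (α₀ ^ 2 * (10 * δ₀) ^ 2) := by
  constructor <;> simp only [initial, q]
  · exact hα
  · positivity
  · have : (δ₀ / (1 / 10)) ^ 2 ≤ 1 := by
      rw [sq_le_one_iff₀ (by positivity), div_le_one (by norm_num)]
      exact hδ'
    nlinarith
  · ring
  · field_simp
  · field_simp

theorem initial_delta {Q δ₀ α₀ : ℝ} (hδ : 0 < δ₀) (hα : 0 < α₀) :
    (initial Q δ₀ α₀).delta = δ₀ := by
  have : α₀ * (δ₀ / q) ^ 2 / α₀ = (δ₀ / q) ^ 2 := by field_simp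
  simp only [delta, initial]
  rw [this, Real.sqrt_sq (by unfold q; positivity), q]
  field_simp

end Eig

/-! ### The weight as a tree -/

/-- The factor `(1 - 1 / K)^{1/2}` of the oscillation when stopping. -/
def osc (K : ℝ) : ℝ := Real.sqrt (1 - 1 / K)

theorem osc_nonneg (K : ℝ) : 0 ≤ osc K := Real.sqrt_nonneg _

theorem osc_sq {K : ℝ} (hK : 1 ≤ K) : osc K ^ 2 = 1 - 1 / K := by
  rw [osc, Real.sq_sqrt]
  have : 1 / K ≤ 1 := by rwa [div_le_one (by linarith)]
  linarith

theorem osc_lt_one {K : ℝ} (hK : 1 ≤ K) : osc K < 1 := by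
  have h := osc_sq hK
  have : 0 < 1 / K := by positivity
  nlinarith [osc_nonneg K]

/-- The tree of `stopWeight`. -/
def stopTree (p : Eig) (a b : Plane) : Tree Mat :=
  let da := osc (p.al * p.beS)
  let db := osc (p.be * p.alS)
  .node (.leaf (diagMat a b (p.beS * (1 - da)) (p.alS * (1 - db))))
    (.leaf (diagMat a b (p.beS * (1 + da)) (p.alS * (1 + db))))

theorem stopTree_eval (p : Eig) (a b : Plane) (x : ℝ) :
    (stopTree p a b).eval x = stopWeight p a b x := rfl

/-- The tree of `weightAux`. -/
def weightTree (Q : ℝ) : ℕ → Eig → Plane → Plane → Tree Mat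
  | 0, p, a, b => stopTree p a b
  | N + 1, p, a, b =>
    .node
      (.node (stopTree (p.terminal Q) (turn (-p.delta) a b) (turn p.delta b a))
        (weightTree Q N (p.next Q) (turn (-p.delta) a b) (turn p.delta b a)))
      (.node (stopTree (p.terminal Q) (turn p.delta a b) (turn (-p.delta) b a))
        (weightTree Q N (p.next Q) (turn p.delta a b) (turn (-p.delta) b a)))

theorem weightTree_eval (Q : ℝ) : ∀ (N : ℕ) (p : Eig) (a b : Plane) (x : ℝ),
    (weightTree Q N p a b).eval x = weightAux Q N p a b x
  | 0, p, a, b, x => stopTree_eval p a b x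
  | N + 1, p, a, b, x => by
    simp only [weightTree, Tree.eval, weightAux, weightTree_eval Q N, stopTree_eval]
    by_cases h1 : x < 1 / 4
    · rw [if_pos (by linarith), if_pos (by linarith), if_pos h1]
      congr 1
      ring
    · by_cases h2 : x < 1 / 2
      · rw [if_pos h2, if_neg (by linarith), if_neg h1, if_pos h2]
        congr 1
        ring
      · by_cases h3 : x < 3 / 4
        · rw [if_neg h2, if_pos (by linarith), if_neg h1, if_neg h2, if_pos h3]
          congr 1
          ring
        · rw [if_neg h2, if_neg (by linarith), if_neg h1, if_neg h2, if_neg h3]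
          congr 1
          ring

/-- The bound of the `A₂` characteristic by `Q` on one interval. -/
def A2Le (Q : ℝ) (A B : Mat) : Prop := opNorm (sqrtMat A * sqrtMat B) ^ 2 ≤ Q

theorem Tree.meanInv_node (l r : Tree Mat) :
    (Tree.node l r).meanInv = (1 / 2 : ℝ) • (l.meanInv + r.meanInv) := rfl

theorem Tree.mean_node (l r : Tree Mat) :
    (Tree.node l r).mean = (1 / 2 : ℝ) • (l.mean + r.mean) := rfl

/-- All that the averages of the weight on an interval have to satisfy: `β# a a* + α# b b*` is the
average, `α a a* + β b b*` is the average of the inverse, and the characteristic is at most `Q`. -/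
structure IsWeightTree (Q : ℝ) (al be alS beS : ℝ) (a b : Plane) (t : Tree Mat) : Prop where
  posDef : t.All Matrix.PosDef
  mean : t.mean = diagMat a b beS alS
  meanInv : t.meanInv = diagMat a b al be
  char : t.AllAverages (A2Le Q)

theorem IsWeightTree.leaf {Q : ℝ} (hQ : 1 ≤ Q) {a b : Plane} (hab : Axes a b) {x y : ℝ}
    (hx : 0 < x) (hy : 0 < y) :
    IsWeightTree Q x⁻¹ y⁻¹ y x a b (.leaf (diagMat a b x y)) := by
  refine ⟨hab.posDef hx hy, rfl, hab.diagMat_inv hx hy, ?_⟩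
  rw [Tree.AllAverages, A2Le, hab.diagMat_inv hx hy, hab.opNorm_sq hx.le hy.le
    (inv_pos.2 hx).le (inv_pos.2 hy).le (mul_inv_cancel₀ hx.ne') (mul_inv_cancel₀ hy.ne')]
  exact hQ

/-- Gluing along common axes. -/
theorem IsWeightTree.node {Q K : ℝ} {x y z w x₁ y₁ z₁ w₁ x₂ y₂ z₂ w₂ : ℝ} {a b : Plane}
    (hab : Axes a b) {l r : Tree Mat}
    (hl : IsWeightTree Q x₁ y₁ z₁ w₁ a b l) (hr : IsWeightTree Q x₂ y₂ z₂ w₂ a b r)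
    (ex : (x₁ + x₂) / 2 = x) (ey : (y₁ + y₂) / 2 = y) (ez : (z₁ + z₂) / 2 = z)
    (ew : (w₁ + w₂) / 2 = w) (hx : 0 ≤ x) (hy : 0 ≤ y) (hz : 0 ≤ z) (hw : 0 ≤ w)
    (hK : w * x = K) (hK' : z * y = K) (hKQ : K ≤ Q) :
    IsWeightTree Q x y z w a b (.node l r) := by
  have h1 : (Tree.node l r).mean = diagMat a b w z := by
    rw [Tree.mean_node, hl.mean, hr.mean, diagMat_add_diagMat, ew, ez]
  have h2 : (Tree.node l r).meanInv = diagMat a b x y := by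
    rw [Tree.meanInv_node, hl.meanInv, hr.meanInv, diagMat_add_diagMat, ex, ey]
  refine ⟨⟨hl.posDef, hr.posDef⟩, h1, h2, ?_, hl.char, hr.char⟩
  rw [h1, h2, A2Le, hab.opNorm_sq hw hz hx hy hK hK']
  exact hKQ

theorem isWeightTree_stopTree {Q K : ℝ} {p : Eig} (hp : p.Stoppable K) (hK : K ≤ Q) {a b : Plane}
    (hab : Axes a b) : IsWeightTree Q p.al p.be p.alS p.beS a b (stopTree p a b) := by
  obtain ⟨h1, h2, h3, h4, h5, h6, h7⟩ := hp
  have h8 := osc_lt_one h5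
  have h9 := osc_nonneg K
  have h10 := osc_sq h5
  have hK0 : 0 < K := by linarith
  have h11 : (1 - osc K) * (1 + osc K) = 1 / K := by linear_combination -h10
  have hm : 0 < 1 - osc K := by linarith
  have hp : 0 < 1 + osc K := by linarith
  -- The mean of the inverses `1/(1 ∓ osc K)` is `1/(1 - osc K ^ 2) = K`.
  have key : ∀ x y : ℝ, 0 < x → 0 < y → y * x = K →
      ((x * (1 - osc K))⁻¹ + (x * (1 + osc K))⁻¹) / 2 = y := fun x y hx hy hxy => by
    have h12 : (x * (1 - osc K))⁻¹ + (x * (1 + osc K))⁻¹ =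
        2 / (x * ((1 - osc K) * (1 + osc K))) := by
      field_simp
      ring
    rw [h12, h11, ← hxy]
    field_simp
  rw [stopTree, h6, h7]
  refine IsWeightTree.node (K := K) hab
    (IsWeightTree.leaf (h5.trans hK) hab (mul_pos h4 hm) (mul_pos h3 hm))
    (IsWeightTree.leaf (h5.trans hK) hab (mul_pos h4 hp) (mul_pos h3 hp))
    (key _ _ h4 h1 h6) (key _ _ h3 h2 h7) (by ring) (by ring) h1.le h2.le h3.le h4.le
    (by rw [mul_comm, h6]) (by rw [mul_comm, h7]) hK

/-- On a rotated half, before the stretching, both products of eigenvalues equal `Q s`, and `s ≤ 1`.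
-/
theorem isWeightTree_half {Q D : ℝ} (hQ : 10 ≤ Q) {p : Eig} (hp : p.Valid Q D) {a b : Plane}
    (hab : Axes a b) {t : Tree Mat} (ht : IsWeightTree Q (p.next Q).al (p.next Q).be
      (p.next Q).alS (p.next Q).beS a b t) :
    IsWeightTree Q p.rotated.al p.rotated.be p.rotated.alS p.rotated.beS a b
      (.node (stopTree (p.terminal Q) a b) t) := by
  have h1 := hp.rotated_al_pos
  have h2 := hp.rotated_be_pos
  have h3 := hp.det_pos
  have hr := hp.ratio_bounds hQ
  have e1 : p.rotated.beS * p.rotated.al = Q * p.ratio Q := by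
    rw [Eig.ratio]; field_simp
  refine IsWeightTree.node (K := Q * p.ratio Q) hab (isWeightTree_stopTree
    (hp.terminal_stoppable hQ) ((hp.terminal_le_two hQ).trans (by linarith)) hab) ht
    ?_ ?_ ?_ ?_ h1.le h2.le ?_ ?_ e1 ?_ ?_
  · simp only [Eig.terminal, Eig.next]; ring
  · simp only [Eig.terminal, Eig.next]; ring
  · simp only [Eig.terminal, Eig.next]; ring
  · simp only [Eig.terminal, Eig.next]; ring
  · rw [hp.rotated_alS]; positivity
  · rw [hp.rotated_beS]; positivity
  · rw [← e1, hp.rotated_alS, hp.rotated_beS]; ring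
  · nlinarith

theorem isWeightTree_weightTree {Q D : ℝ} (hQ : 10 ≤ Q) : ∀ (N : ℕ) {p : Eig} {a b : Plane},
    p.Valid Q D → Axes a b → IsWeightTree Q p.al p.be p.alS p.beS a b (weightTree Q N p a b)
  | 0, p, a, b, hp, hab => isWeightTree_stopTree (hp.stoppable hQ) le_rfl hab
  | N + 1, p, a, b, hp, hab => by
    have hl := isWeightTree_half hQ hp (hab.turn_neg p.delta)
      (isWeightTree_weightTree hQ N (hp.next hQ) (hab.turn_neg p.delta))
    have hr := isWeightTree_half hQ hp (hab.turn p.delta)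
      (isWeightTree_weightTree hQ N (hp.next hQ) (hab.turn p.delta))
    have h1 : (weightTree Q (N + 1) p a b).mean = diagMat a b p.beS p.alS := by
      rw [weightTree, Tree.mean_node, hl.mean, hr.mean, diagMat_turn_add, hp.mean_alS, hp.mean_beS]
    have h2 : (weightTree Q (N + 1) p a b).meanInv = diagMat a b p.al p.be := by
      rw [weightTree, Tree.meanInv_node, hl.meanInv, hr.meanInv, diagMat_turn_add, hp.mean_al,
        hp.mean_be]
    have hs := hp.stoppable hQ
    refine ⟨⟨hl.posDef, hr.posDef⟩, h1, h2, ?_, hl.char, hr.char⟩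
    change A2Le Q (weightTree Q (N + 1) p a b).mean (weightTree Q (N + 1) p a b).meanInv
    rw [h1, h2, A2Le, hab.opNorm_sq (K := Q) hs.beS_pos.le hs.alS_pos.le hs.al_pos.le hs.be_pos.le
      (by rw [mul_comm, hs.al_beS]) (by rw [mul_comm, hs.be_alS])]

/-- The characteristic of the weight is exactly `Q`. -/
theorem hasDyadicA2Char_weightTree {Q D : ℝ} (hQ : 10 ≤ Q) (N : ℕ) {p : Eig} {a b : Plane}
    (hp : p.Valid Q D) (hab : Axes a b) :
    HasDyadicA2Char (weightTree Q N p a b).eval Q := by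
  have h := isWeightTree_weightTree hQ N hp hab
  have hs := hp.stoppable hQ
  have hinv : (fun x => ((weightTree Q N p a b).eval x)⁻¹) =
      ((weightTree Q N p a b).map fun A => A⁻¹).eval :=
    funext fun x => (Tree.eval_map (fun A : Mat => A⁻¹) _ x).symm
  rw [HasDyadicA2Char, hinv]
  constructor
  · rintro _ ⟨I, rfl⟩
    exact h.char.average I
  · intro y hy
    -- The value `Q` is attained on the whole interval.
    have := hy ⟨DyadicInterval.root, rfl⟩
    simp only [average_eval_root] at this
    rw [← Tree.meanInv, h.mean, h.meanInv, hab.opNorm_sq (K := Q) hs.beS_pos.le hs.alS_pos.le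
      hs.al_pos.le hs.be_pos.le (by rw [mul_comm, hs.al_beS])
      (by rw [mul_comm, hs.be_alS])] at this
    exact this

/-! ### One step of the recursion for the energy -/

/-- The jump that is caused by the rotation. -/
def turnJump (p : Eig) (a b e : Plane) : Plane :=
  jump (act (diagMat (turn (-p.delta) a b) (turn p.delta b a) p.rotated.al p.rotated.be) e)
    (act (diagMat (turn p.delta a b) (turn (-p.delta) b a) p.rotated.al p.rotated.be) e)

/-- The jump that is caused by the stretching. -/
def stretchJump (Q : ℝ) (p : Eig) (a b e : Plane) : Plane :=
  jump (act (diagMat a b (p.terminal Q).al (p.terminal Q).be) e)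
    (act (diagMat a b (p.next Q).al (p.next Q).be) e)

theorem inner_jump (g u v : Plane) :
    inner ℝ g (jump u v) = Real.sqrt 2 / 2 * (inner ℝ g v - inner ℝ g u) := by
  rw [jump, real_inner_smul_right, inner_sub_right]

/-- Only the part odd in `δ` survives in the difference of the two rotated matrices; it exchanges
the axes, so this component sees `(b, e)`. -/
theorem inner_turnJump (p : Eig) {a b : Plane} (hab : Axes a b) (e : Plane) :
    inner ℝ a (turnJump p a b e) = Real.sqrt 2 * p.delta * lam p.delta ^ 2 *
      (p.rotated.al - p.rotated.be) * inner ℝ b e := by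
  have h1 : ∀ δ : ℝ, inner ℝ a (turn δ a b) = lam δ := fun δ => by
    rw [real_inner_comm, inner_turn, hab.aa, hab.ba]; ring
  have h2 : ∀ δ : ℝ, inner ℝ a (turn δ b a) = lam δ * δ := fun δ => by
    rw [real_inner_comm, inner_turn, hab.aa, hab.ba]; ring
  rw [turnJump, inner_jump, act_diagMat, act_diagMat, inner_add_right, inner_add_right,
    real_inner_smul_right, real_inner_smul_right, real_inner_smul_right, real_inner_smul_right,
    h1, h1, h2, h2, inner_turn, inner_turn, inner_turn, inner_turn, lam_neg]
  ring

theorem inner_stretchJump (Q : ℝ) (p : Eig) {a b : Plane} (hab : Axes a b) (e : Plane) :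
    inner ℝ a (stretchJump Q p a b e) =
      Real.sqrt 2 * (stretch Q - 1) * p.rotated.al * inner ℝ a e := by
  rw [stretchJump, inner_jump, act_diagMat, act_diagMat, inner_add_right, inner_add_right,
    real_inner_smul_right, real_inner_smul_right, real_inner_smul_right, real_inner_smul_right,
    hab.aa, hab.ab]
  simp only [Eig.terminal, Eig.next]
  ring

section recursion

variable {Q D : ℝ} {p : Eig} {a b : Plane}

theorem energy_half (hQ : 10 ≤ Q) (N : ℕ) (hp : p.Valid Q D) (hab : Axes a b) (e G P : Plane) :
    Tree.energy e (.node (stopTree (p.terminal Q) a b) (weightTree Q N (p.next Q) a b)) G P =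
      1 / 2 * (Tree.energy e (stopTree (p.terminal Q) a b) (G - P) (-stretchJump Q p a b e) +
        Tree.energy e (weightTree Q N (p.next Q) a b) (G + P) (stretchJump Q p a b e)) := by
  rw [Tree.energy, (isWeightTree_stopTree (hp.terminal_stoppable hQ)
    ((hp.terminal_le_two hQ).trans (by linarith : (2 : ℝ) ≤ Q)) hab).meanInv,
    (isWeightTree_weightTree hQ N (hp.next hQ) hab).meanInv, stretchJump]

/-- Two levels of the tree make one generation. The rotation jump enters with opposite signs on the
terminal and the stopping quarter of each half, and the stretching jump becomes the new `P` of the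
quarter. -/
theorem energy_weightTree_succ (hQ : 10 ≤ Q) (N : ℕ) (hp : p.Valid Q D) (hab : Axes a b)
    (e G P : Plane) :
    Tree.energy e (weightTree Q (N + 1) p a b) G P = 1 / 4 *
      ((Tree.energy e (stopTree (p.terminal Q) (turn (-p.delta) a b) (turn p.delta b a))
          (G - P + turnJump p a b e)
          (-stretchJump Q p (turn (-p.delta) a b) (turn p.delta b a) e) +
        Tree.energy e (stopTree (p.terminal Q) (turn p.delta a b) (turn (-p.delta) b a))
          (G + P - turnJump p a b e)
          (-stretchJump Q p (turn p.delta a b) (turn (-p.delta) b a) e)) +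
      (Tree.energy e (weightTree Q N (p.next Q) (turn (-p.delta) a b) (turn p.delta b a))
          (G - P - turnJump p a b e)
          (stretchJump Q p (turn (-p.delta) a b) (turn p.delta b a) e) +
        Tree.energy e (weightTree Q N (p.next Q) (turn p.delta a b) (turn (-p.delta) b a))
          (G + P + turnJump p a b e)
          (stretchJump Q p (turn p.delta a b) (turn (-p.delta) b a) e))) := by
  have hl := isWeightTree_half hQ hp (hab.turn_neg p.delta)
    (isWeightTree_weightTree hQ N (hp.next hQ) (hab.turn_neg p.delta))
  have hr := isWeightTree_half hQ hp (hab.turn p.delta)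
    (isWeightTree_weightTree hQ N (hp.next hQ) (hab.turn p.delta))
  rw [weightTree, Tree.energy, hl.meanInv, hr.meanInv, ← turnJump,
    energy_half hQ N hp (hab.turn_neg p.delta), energy_half hQ N hp (hab.turn p.delta),
    sub_neg_eq_add, ← sub_eq_add_neg]
  ring

/-- As `K ≤ 2`, the oscillation is at most `3/4`, so each value of the weight dominates a quarter of
its average. The four values of the function are `G ± P ± J`, and their cross terms cancel in the
sum of squares. -/
theorem energy_stopTree_ge {K : ℝ} (hp : p.Stoppable K) (hK : K ≤ 2) (e G P : Plane) :
    p.alS / 4 * inner ℝ b G ^ 2 ≤ Tree.energy e (stopTree p a b) G P := by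
  obtain ⟨h1, h2, h3, h4, h5, h6, h7⟩ := hp
  have h9 := osc_nonneg K
  have hosc : osc K ≤ 3 / 4 := by
    have h10 := osc_sq h5
    have : 1 / 2 ≤ 1 / K := one_div_le_one_div_of_le (by linarith) hK
    nlinarith
  have hm : ∀ g, p.alS / 4 * inner ℝ b g ^ 2 ≤
      quad (diagMat a b (p.beS * (1 - osc K)) (p.alS * (1 - osc K))) g := fun g => by
    rw [quad_diagMat]
    have : 0 ≤ p.beS * (1 - osc K) * inner ℝ a g ^ 2 :=
      mul_nonneg (mul_nonneg h4.le (by linarith)) (sq_nonneg _)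
    have : p.alS / 4 ≤ p.alS * (1 - osc K) := by nlinarith
    nlinarith [sq_nonneg (inner ℝ b g)]
  have hq : ∀ g, p.alS / 4 * inner ℝ b g ^ 2 ≤
      quad (diagMat a b (p.beS * (1 + osc K)) (p.alS * (1 + osc K))) g := fun g => by
    rw [quad_diagMat]
    have : 0 ≤ p.beS * (1 + osc K) * inner ℝ a g ^ 2 :=
      mul_nonneg (mul_nonneg h4.le (by linarith)) (sq_nonneg _)
    have : p.alS / 4 ≤ p.alS * (1 + osc K) := by nlinarith
    nlinarith [sq_nonneg (inner ℝ b g)]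
  rw [stopTree, h6, h7, Tree.energy, Tree.energy, Tree.energy]
  set J := jump (act (Tree.leaf (diagMat a b (p.beS * (1 - osc K))
    (p.alS * (1 - osc K)))).meanInv e) (act (Tree.leaf (diagMat a b (p.beS * (1 + osc K))
    (p.alS * (1 + osc K)))).meanInv e)
  have e1 := hm (G - P - -J)
  have e2 := hm (G - P + -J)
  have e3 := hq (G + P - J)
  have e4 := hq (G + P + J)
  simp only [inner_sub_right, inner_add_right, inner_neg_right] at e1 e2 e3 e4
  have h8 : 0 ≤ p.alS / 4 * (inner ℝ b P ^ 2 + inner ℝ b J ^ 2) := by positivity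
  nlinarith

/-! ### The lower bound for the energy -/

/-- The square of the positive part. -/
def posSq (u : ℝ) : ℝ := max 0 u ^ 2

theorem posSq_nonneg (u : ℝ) : 0 ≤ posSq u := sq_nonneg _

theorem posSq_mono {u v : ℝ} (h : u ≤ v) : posSq u ≤ posSq v :=
  pow_le_pow_left₀ (le_max_left _ _) (max_le_max le_rfl h) 2

theorem posSq_le_sq (u : ℝ) : posSq u ≤ u ^ 2 := by
  unfold posSq
  rcases le_total 0 u with h | h
  · rw [max_eq_right h]
  · rw [max_eq_left h, zero_pow two_ne_zero]
    exact sq_nonneg u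

/-- Jensen's inequality combined with monotonicity. The positive part is needed because only lower
bounds on means are available, and the plain square is not monotone. -/
theorem two_mul_posSq_le {u v w : ℝ} (h : 2 * w ≤ u + v) :
    2 * posSq w ≤ posSq u + posSq v := by
  have h1 : posSq w ≤ posSq ((u + v) / 2) := posSq_mono (by linarith)
  have h2 : 2 * posSq ((u + v) / 2) ≤ posSq u + posSq v := by
    unfold posSq
    have h3 : max 0 ((u + v) / 2) ≤ (max 0 u + max 0 v) / 2 := by
      refine max_le ?_ ?_
      · have := le_max_left 0 u
        have := le_max_left 0 v
        linarith
      · have := le_max_right 0 u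
        have := le_max_right 0 v
        linarith
    have h4 := pow_le_pow_left₀ (le_max_left 0 ((u + v) / 2)) h3 2
    nlinarith [sq_nonneg (max 0 u - max 0 v)]
  linarith

/-- For `u ≤ 0` the left side vanishes, so constants may be lowered without knowing the sign of `u`.
-/
theorem posSq_mul_le {c c' u v : ℝ} (hc : 0 ≤ c) (hcc' : c ≤ c') (huv : 0 < u → u ≤ v) :
    posSq (c * u) ≤ posSq (c' * v) := by
  rcases le_or_gt u 0 with hu | hu
  · have : c * u ≤ 0 := mul_nonpos_of_nonneg_of_nonpos hc hu
    rw [posSq, max_eq_left this, zero_pow two_ne_zero]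
    exact posSq_nonneg _
  · exact posSq_mono (mul_le_mul hcc' (huv hu) hu.le (hc.trans hcc'))

/-! ### Persistence of the alignment under rotations. -/

theorem lam_le_one (δ : ℝ) : lam δ ≤ 1 := by
  nlinarith [lam_sq δ, lam_pos δ, sq_nonneg δ, sq_nonneg (lam δ * δ)]

theorem one_sub_le_lam (δ : ℝ) : 1 - δ ^ 2 / 2 ≤ lam δ := by
  have h1 := lam_sq δ
  have h2 := lam_pos δ
  by_contra! h
  have h4 : lam δ ^ 2 < (1 - δ ^ 2 / 2) ^ 2 := by nlinarith
  have h5 : (1 - δ ^ 2 / 2) ^ 2 * (1 + δ ^ 2) ≤ 1 := by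
    have h6 : δ ^ 2 ≤ 2 := by nlinarith
    nlinarith [sq_nonneg δ, mul_nonneg (sq_nonneg δ) (sq_nonneg δ), mul_nonneg
      (mul_nonneg (sq_nonneg δ) (sq_nonneg δ)) (sub_nonneg.2 h6)]
  nlinarith [sq_nonneg δ]

/-- The test vector `e` is still close enough to the first axis. -/
structure Aligned (p : Eig) (a b e : Plane) : Prop where
  axes : Axes a b
  delta_le : p.delta ≤ 1 / 40
  norm_le : inner ℝ e e ≤ (2 : ℝ)
  ge : 1 / 2 + 4 * p.delta ≤ inner ℝ a e

namespace Aligned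

variable {e : Plane}

theorem abs_b_le (h : Aligned p a b e) : |inner ℝ b e| ≤ 3 / 2 := by
  have := h.axes.inner_self e
  have := h.norm_le
  exact abs_le_of_sq_le_sq (by nlinarith [sq_nonneg (inner ℝ a e)]) (by norm_num)

/-- One rotation loses at most `3/2 · δ` plus terms quadratic in `δ`. The margin `4δ` therefore
remains at least `12/5 · δ = 4 · (3/5) δ`, which covers the margin for the next `δ`: the condition
reproduces itself. -/
theorem ge_turn (h : Aligned p a b e) (hp : p.Valid Q D) {δ : ℝ} (hδ : |δ| = p.delta) :
    1 / 2 + 12 / 5 * p.delta ≤ lam δ * (inner ℝ a e + δ * inner ℝ b e) := by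
  have h1 := hp.delta_pos
  have h2 := one_sub_le_lam δ
  have h3 : δ ^ 2 = p.delta ^ 2 := by rw [← hδ, sq_abs]
  have h4 : |δ * inner ℝ b e| ≤ p.delta * (3 / 2) := by
    rw [abs_mul, hδ]
    exact mul_le_mul_of_nonneg_left h.abs_b_le h1.le
  have h5 := (abs_le.1 h4).1
  have h6 := h.ge
  have h7 := h.delta_le
  have h8 := lam_le_one δ
  have h9 : p.delta ^ 2 / 2 ≤ p.delta / 80 := by nlinarith
  have h10 : 1 / 2 + 5 / 2 * p.delta ≤ inner ℝ a e + δ * inner ℝ b e := by linarith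
  have h11 : 1 - p.delta / 80 ≤ lam δ := by rw [h3] at h2; linarith
  have h12 : (1 - p.delta / 80) * (1 / 2 + 5 / 2 * p.delta) ≤
      lam δ * (inner ℝ a e + δ * inner ℝ b e) :=
    mul_le_mul h11 h10 (by positivity) (lam_pos δ).le
  nlinarith

theorem next_right (h : Aligned p a b e) (hp : p.Valid Q D) (hQ : 10 ≤ Q) :
    Aligned (p.next Q) (turn p.delta a b) (turn (-p.delta) b a) e := by
  have h1 := hp.next_delta_le hQ
  have h2 := hp.delta_pos
  refine ⟨h.axes.turn _, by linarith [h.delta_le], h.norm_le, ?_⟩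
  rw [inner_turn]
  linarith [h.ge_turn hp (abs_of_pos h2)]

theorem next_left (h : Aligned p a b e) (hp : p.Valid Q D) (hQ : 10 ≤ Q) :
    Aligned (p.next Q) (turn (-p.delta) a b) (turn p.delta b a) e := by
  have h1 := hp.next_delta_le hQ
  have h2 := hp.delta_pos
  refine ⟨h.axes.turn_neg _, by linarith [h.delta_le], h.norm_le, ?_⟩
  rw [inner_turn]
  have := h.ge_turn hp (δ := -p.delta) (by rw [abs_neg, abs_of_pos h2])
  linarith

end Aligned

theorem le_inner_stretchJump {e : Plane} (hp : p.Valid Q D) (hQ : 10 ≤ Q)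
    (h : Aligned (p.next Q) a b e) :
    (p.next Q).al / 4 ≤ inner ℝ a (stretchJump Q p a b e) := by
  obtain ⟨h3, h4⟩ := stretch_bounds hQ
  have h5 : (p.next Q).al = stretch Q * p.rotated.al := rfl
  have h6 := hp.rotated_al_pos
  have h7 : (7 : ℝ) / 5 ≤ Real.sqrt 2 := Real.le_sqrt_of_sq_le (by norm_num)
  have h8 : 1 / 2 ≤ inner ℝ a e := by linarith [h.ge, (hp.next hQ).delta_pos]
  rw [inner_stretchJump Q p h.axes, h5]
  have h9 : (7 : ℝ) / 5 * (9 / 10) ≤ Real.sqrt 2 * (stretch Q - 1) :=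
    mul_le_mul h7 (by linarith) (by norm_num) (by positivity)
  have h10 : (7 : ℝ) / 5 * (9 / 10) * p.rotated.al * (1 / 2) ≤
      Real.sqrt 2 * (stretch Q - 1) * p.rotated.al * inner ℝ a e := by
    refine mul_le_mul (mul_le_mul_of_nonneg_right h9 h6.le) h8 (by norm_num) ?_
    have : 0 < stretch Q - 1 := by linarith
    positivity
  nlinarith

/-- The jump carries a factor `δ ≤ 1/40`, which makes it at most `9/80 · α`, so at least half of the
guaranteed `α/4` in `P` is left. -/
theorem abs_inner_turnJump_le {e : Plane} (hp : p.Valid Q D) (h : Aligned p a b e) :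
    |inner ℝ a (turnJump p a b e)| ≤ p.al / 8 := by
  have h1 := hp.rotated_al_pos
  have h2 := hp.rotated_be_pos
  have h3 := hp.rotated_al_le
  have h4 : p.rotated.be ≤ p.rotated.al :=
    (hp.rotated_be_le.trans hp.be_le).trans hp.le_rotated_al
  have h5 := hp.delta_pos
  have h6 := h.delta_le
  have h7 : Real.sqrt 2 ≤ 3 / 2 := Real.sqrt_le_iff.2 (by norm_num)
  have h8 : lam p.delta ^ 2 ≤ 1 := pow_le_one₀ (lam_pos _).le (lam_le_one _)
  have h9 := hp.al_pos
  have h10 : 0 ≤ p.rotated.al - p.rotated.be := by linarith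
  rw [inner_turnJump p h.axes, abs_mul, abs_of_nonneg (by positivity)]
  calc Real.sqrt 2 * p.delta * lam p.delta ^ 2 * (p.rotated.al - p.rotated.be) * |inner ℝ b e|
      ≤ 3 / 2 * (1 / 40) * 1 * (2 * p.al) * (3 / 2) := by
        have := h.abs_b_le
        gcongr
        linarith
    _ ≤ p.al / 8 := by nlinarith

/-! ### Accumulation of the drift over the generations. -/

/-- The drift of the second component of the Haar shift. -/
def drift (D : ℝ) : ℝ := Real.sqrt D / 80

theorem al_mul_delta (hp : p.Valid Q D) : p.al * p.delta = 8 * drift D := by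
  have h1 := hp.al_mul_delta_sq
  have h2 := hp.al_pos
  have h3 := hp.delta_pos
  have h4 : D = (10 * (p.al * p.delta)) ^ 2 := by rw [mul_pow, h1]; ring
  have h5 : Real.sqrt D = 10 * (p.al * p.delta) := by
    rw [h4, Real.sqrt_sq (by positivity)]
  rw [drift, h5]
  ring

/-- The lower bound for the energy on a stopping interval of the `n`-th next generation. -/
def level (Q D : ℝ) (p : Eig) (y : ℝ) (n : ℕ) : ℝ :=
  (1 / 2) ^ (n + 1) * (p.al * stretch Q ^ n / (4 * D)) *
    posSq ((1 - p.delta ^ 2) * (y + (n + 1) * drift D))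

/-- Jensen passes from the two stopping quarters to the mean of `u` and `v`. The factor `1 - δ²`
absorbs the shrinking by `lam` in all later generations: as `δ'² ≤ δ²/2` for the next `δ'`, one has
`(1 - δ'²) lam δ ≥ (1 - δ²/2)² ≥ 1 - δ²`. -/
theorem level_succ_le (hQ : 10 ≤ Q) (hp : p.Valid Q D) (n : ℕ) {y u v : ℝ}
    (h : 2 * (lam p.delta * (y + drift D)) ≤ u + v) :
    level Q D p y (n + 1) ≤ 1 / 4 * (level Q D (p.next Q) u n + level Q D (p.next Q) v n) := by
  have hD := hp.det_pos
  have hd : 0 < drift D := by unfold drift; positivity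
  have h0 := (stretch_bounds hQ).1
  have hδ := hp.next_delta_le hQ
  have hδ0 := hp.delta_pos
  have hδ1 := (hp.next hQ).delta_pos
  have hη : 0 ≤ 1 - p.delta ^ 2 := by linarith [hp.delta_sq_le]
  have hη' : 0 ≤ 1 - (p.next Q).delta ^ 2 := by linarith [(hp.next hQ).delta_sq_le]
  set w := (1 - (p.next Q).delta ^ 2) * (lam p.delta * (y + (n + 2) * drift D))
  have h1 : posSq ((1 - p.delta ^ 2) * (y + ((n + 1 : ℕ) + 1) * drift D)) ≤ posSq w := by
    have e1 : w = ((1 - (p.next Q).delta ^ 2) * lam p.delta) * (y + (n + 2) * drift D) := by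
      simp only [w]; ring
    rw [e1]
    refine posSq_mul_le hη ?_ fun _ => ?_
    · have h2 := one_sub_le_lam p.delta
      have h3 : (p.next Q).delta ^ 2 ≤ p.delta ^ 2 / 2 := by nlinarith
      have h4 : p.delta ^ 2 ≤ 1 / 100 := hp.delta_sq_le
      calc 1 - p.delta ^ 2 ≤ (1 - p.delta ^ 2 / 2) * (1 - p.delta ^ 2 / 2) := by
            nlinarith [sq_nonneg (p.delta ^ 2)]
        _ ≤ _ := mul_le_mul (by linarith) h2 (by linarith) hη'
    · push_cast
      linarith
  have h2 : 2 * posSq w ≤ posSq ((1 - (p.next Q).delta ^ 2) * (u + (n + 1) * drift D)) +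
      posSq ((1 - (p.next Q).delta ^ 2) * (v + (n + 1) * drift D)) := by
    refine two_mul_posSq_le ?_
    have h3 : lam p.delta * (y + (n + 2) * drift D) ≤
        (u + v) / 2 + (n + 1) * drift D := by
      have : lam p.delta * ((n + 1) * drift D) ≤ 1 * ((n + 1) * drift D) :=
        mul_le_mul_of_nonneg_right (lam_le_one _) (by positivity)
      linarith
    have := mul_le_mul_of_nonneg_left h3 hη'
    simp only [w]
    linarith
  have h3 : p.al * stretch Q ≤ (p.next Q).al := by
    have : (p.next Q).al = stretch Q * p.rotated.al := rfl
    rw [this, mul_comm]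
    exact mul_le_mul_of_nonneg_left hp.le_rotated_al (by linarith)
  have h4 : p.al * stretch Q ^ (n + 1) / (4 * D) ≤ (p.next Q).al * stretch Q ^ n / (4 * D) := by
    rw [pow_succ', ← mul_assoc]
    gcongr
  have hal := (hp.next hQ).al_pos
  have h5 : 0 ≤ p.al * stretch Q ^ (n + 1) / (4 * D) := by
    have := hp.al_pos
    positivity
  set X := (p.next Q).al * stretch Q ^ n / (4 * D)
  calc level Q D p y (n + 1)
      ≤ (1 / 2) ^ (n + 1 + 1) * X * posSq w := by
        unfold level
        have := posSq_nonneg ((1 - p.delta ^ 2) * (y + ((n + 1 : ℕ) + 1) * drift D))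
        gcongr
    _ = 1 / 4 * ((1 / 2) ^ (n + 1) * X * (2 * posSq w)) := by ring
    _ ≤ 1 / 4 * ((1 / 2) ^ (n + 1) * X *
          (posSq ((1 - (p.next Q).delta ^ 2) * (u + (n + 1) * drift D)) +
            posSq ((1 - (p.next Q).delta ^ 2) * (v + (n + 1) * drift D)))) := by
        have : 0 ≤ X := by positivity
        gcongr
    _ = _ := by unfold level; ring

theorem level_zero_le (hQ : 10 ≤ Q) (hp : p.Valid Q D) {y u v : ℝ}
    (h : 2 * (lam p.delta * (y + drift D)) ≤ u + v) :
    level Q D p y 0 ≤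
      1 / 4 * ((p.terminal Q).alS / 4 * u ^ 2 + (p.terminal Q).alS / 4 * v ^ 2) := by
  have hD := hp.det_pos
  have hη : 0 ≤ 1 - p.delta ^ 2 := by linarith [hp.delta_sq_le]
  have hl := one_sub_le_lam p.delta
  have h1 : posSq ((1 - p.delta ^ 2) * (y + drift D)) ≤ posSq (lam p.delta * (y + drift D)) :=
    posSq_mul_le hη (by linarith [sq_nonneg p.delta]) fun _ => le_rfl
  have h2 := two_mul_posSq_le h
  have h3 := posSq_le_sq u
  have h4 := posSq_le_sq v
  have h5 := hp.le_rotated_al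
  have h6 := hp.al_pos
  have h7 : 2 * posSq ((1 - p.delta ^ 2) * (y + drift D)) ≤ u ^ 2 + v ^ 2 := by linarith
  have h8 := mul_le_mul (div_le_div_of_nonneg_right h5 hD.le) h7
    (mul_nonneg zero_le_two (posSq_nonneg _)) (div_nonneg hp.rotated_al_pos.le hD.le)
  have e : level Q D p y 0 =
      1 / 16 * (p.al / D * (2 * posSq ((1 - p.delta ^ 2) * (y + drift D)))) := by
    simp only [level, Nat.cast_zero, zero_add, pow_zero, pow_one, one_mul, mul_one]
    field_simp
    ring
  rw [e, hp.terminal_alS hQ]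
  linarith

/-- Induction on the generations: the terminal quarters pay for level `0`, the stopping quarters for
the later levels. The hypothesis on `P` is restored each time by the stretching jump. -/
theorem energy_ge (hQ : 10 ≤ Q) {e : Plane} : ∀ (N : ℕ) {p : Eig} {a b : Plane},
    p.Valid Q D → Aligned p a b e → ∀ G P : Plane, p.al / 4 ≤ inner ℝ a P →
      ∑ n ∈ Finset.range N, level Q D p (-inner ℝ b G) n ≤
        Tree.energy e (weightTree Q N p a b) G P
  | 0, p, a, b, hp, h, G, P, _ => by
    rw [Finset.range_zero, Finset.sum_empty]
    exact Tree.energy_nonneg e (isWeightTree_weightTree hQ 0 hp h.axes).posDef G P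
  | N + 1, p, a, b, hp, h, G, P, hP => by
    have hl := h.next_left hp hQ
    have hr := h.next_right hp hQ
    have hn := hp.next hQ
    have il := energy_ge hQ N hn hl (G - P - turnJump p a b e) _ (le_inner_stretchJump hp hQ hl)
    have ir := energy_ge hQ N hn hr (G + P + turnJump p a b e) _ (le_inner_stretchJump hp hQ hr)
    have ht := hp.terminal_stoppable hQ
    have tl := energy_stopTree_ge (a := turn (-p.delta) a b) (b := turn p.delta b a) ht
      (hp.terminal_le_two hQ) e (G - P + turnJump p a b e)
      (-stretchJump Q p (turn (-p.delta) a b) (turn p.delta b a) e)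
    have tr := energy_stopTree_ge (a := turn p.delta a b) (b := turn (-p.delta) b a) ht
      (hp.terminal_le_two hQ) e (G + P - turnJump p a b e)
      (-stretchJump Q p (turn p.delta a b) (turn (-p.delta) b a) e)
    have hj := abs_le.1 (abs_inner_turnJump_le hp h)
    have hd := al_mul_delta hp
    have hδ := hp.delta_pos
    have hlam := lam_pos p.delta
    -- Here `s` is the rotation jump with either sign, so one estimate serves both the terminal and
    -- the stopping quarters; it uses `δ · α/8 = drift D`.
    have key : ∀ s, |s| ≤ p.al / 8 → lam p.delta * drift D ≤
        lam p.delta * (p.delta * (inner ℝ a P + s)) := fun s hs => by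
      refine mul_le_mul_of_nonneg_left ?_ hlam.le
      have : p.al / 8 ≤ inner ℝ a P + s := by linarith [(abs_le.1 hs).1]
      nlinarith
    have k1 := key _ (abs_inner_turnJump_le hp h)
    have k2 := key (-inner ℝ a (turnJump p a b e))
      (by rw [abs_neg]; exact abs_inner_turnJump_le hp h)
    rw [Finset.sum_range_succ', energy_weightTree_succ hQ N hp h.axes]
    have z := level_zero_le hQ hp (y := -inner ℝ b G)
      (u := -inner ℝ (turn p.delta b a) (G - P + turnJump p a b e))
      (v := -inner ℝ (turn (-p.delta) b a) (G + P - turnJump p a b e)) (by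
        rw [inner_turn, inner_turn, lam_neg]
        simp only [inner_add_right, inner_sub_right]
        linarith)
    have hs : ∑ n ∈ Finset.range N, level Q D p (-inner ℝ b G) (n + 1) ≤
        1 / 4 * (∑ n ∈ Finset.range N, level Q D (p.next Q)
          (-inner ℝ (turn p.delta b a) (G - P - turnJump p a b e)) n +
          ∑ n ∈ Finset.range N, level Q D (p.next Q)
          (-inner ℝ (turn (-p.delta) b a) (G + P + turnJump p a b e)) n) := by
      rw [← Finset.sum_add_distrib, Finset.mul_sum]
      refine Finset.sum_le_sum fun n _ => level_succ_le hQ hp n ?_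
      rw [inner_turn, inner_turn, lam_neg]
      simp only [inner_add_right, inner_sub_right]
      linarith
    rw [neg_sq, neg_sq] at z
    linarith

end recursion

/-! ### The lower bound for the Haar shift -/

section recursion

variable {Q D : ℝ} {p : Eig} {a b : Plane}

/-- At the top `P = 0`, so the first generation gives no drift. Starting from `-drift D` compensates
for it; `(b, e) ≥ 0` makes the rotation jump harmless, and the first terminal quarters are
discarded. -/
theorem energy_zero_ge (hQ : 10 ≤ Q) (N : ℕ) {e : Plane} (hp : p.Valid Q D)
    (h : Aligned p a b e) (hb : 0 ≤ inner ℝ b e) :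
    ∑ n ∈ Finset.range N, level Q D p (-drift D) (n + 1) ≤
      Tree.energy e (weightTree Q (N + 1) p a b) 0 0 := by
  have hl := h.next_left hp hQ
  have hr := h.next_right hp hQ
  have hn := hp.next hQ
  have il := energy_ge hQ N hn hl (0 - 0 - turnJump p a b e) _ (le_inner_stretchJump hp hQ hl)
  have ir := energy_ge hQ N hn hr (0 + 0 + turnJump p a b e) _ (le_inner_stretchJump hp hQ hr)
  have ht : ∀ {a b : Plane}, Axes a b → _ := fun {a b} => isWeightTree_stopTree (a := a) (b := b)
    (hp.terminal_stoppable hQ) ((hp.terminal_le_two hQ).trans (by linarith : (2 : ℝ) ≤ Q))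
  have tl := Tree.energy_nonneg e (ht (h.axes.turn_neg p.delta)).posDef
    (0 - 0 + turnJump p a b e) (-stretchJump Q p (turn (-p.delta) a b) (turn p.delta b a) e)
  have tr := Tree.energy_nonneg e (ht (h.axes.turn p.delta)).posDef
    (0 + 0 - turnJump p a b e) (-stretchJump Q p (turn p.delta a b) (turn (-p.delta) b a) e)
  have hj : 0 ≤ inner ℝ a (turnJump p a b e) := by
    have h1 := hp.delta_pos
    have h2 : 0 ≤ p.rotated.al - p.rotated.be := sub_nonneg.2
      ((hp.rotated_be_le.trans hp.be_le).trans hp.le_rotated_al)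
    rw [inner_turnJump p h.axes]
    positivity
  have hk : 0 ≤ lam p.delta * (p.delta * inner ℝ a (turnJump p a b e)) :=
    mul_nonneg (lam_pos _).le (mul_nonneg hp.delta_pos.le hj)
  have hs : ∑ n ∈ Finset.range N, level Q D p (-drift D) (n + 1) ≤
      1 / 4 * (∑ n ∈ Finset.range N, level Q D (p.next Q)
        (-inner ℝ (turn p.delta b a) (0 - 0 - turnJump p a b e)) n +
        ∑ n ∈ Finset.range N, level Q D (p.next Q)
        (-inner ℝ (turn (-p.delta) b a) (0 + 0 + turnJump p a b e)) n) := by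
    rw [← Finset.sum_add_distrib, Finset.mul_sum]
    refine Finset.sum_le_sum fun n _ => level_succ_le hQ hp n ?_
    rw [inner_turn, inner_turn, lam_neg]
    simp only [inner_add_right, inner_sub_right, inner_zero_right]
    linarith
  rw [energy_weightTree_succ hQ N hp h.axes]
  linarith

/-! ### Summation over the first `Q` generations. -/

/-- Bernoulli's inequality for `r/2 = 1 - 1/(2Q)`: mass in the stopping intervals halves while the
weight grows by `r`, and the product decays only on the scale `Q`. -/
theorem half_le_stretch_pow (hQ : 10 ≤ Q) {n : ℕ} (hn : (n : ℝ) ≤ Q) :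
    1 / 2 ≤ (1 / 2) ^ n * stretch Q ^ n := by
  have h1 : 1 / Q ≤ 1 := by rw [div_le_one (by linarith)]; linarith
  have h2 := one_add_mul_le_pow (a := -(1 / (2 * Q))) (by
    rw [neg_le_neg_iff, div_le_iff₀ (by positivity)]; linarith) n
  have h3 : 1 / 2 * stretch Q = 1 + -(1 / (2 * Q)) := by
    rw [stretch]
    field_simp
    ring
  rw [← mul_pow, h3]
  refine le_trans ?_ h2
  have h4 : (n : ℝ) * (1 / (2 * Q)) ≤ Q * (1 / (2 * Q)) :=
    mul_le_mul_of_nonneg_right hn (by positivity)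
  have h5 : Q * (1 / (2 * Q)) = 1 / 2 := by field_simp
  linarith

theorem le_level_succ (hQ : 10 ≤ Q) (hp : p.Valid Q D) {n : ℕ} (hn : (n : ℝ) + 1 ≤ Q) :
    p.al * ((n : ℝ) + 1) ^ 2 / 409600 ≤ level Q D p (-drift D) (n + 1) := by
  have hD := hp.det_pos
  have hal := hp.al_pos
  have hd : 0 < drift D := by unfold drift; positivity
  have hd2 : drift D ^ 2 = D / 6400 := by
    rw [drift, div_pow, Real.sq_sqrt hD.le]
    norm_num
  have h1 := half_le_stretch_pow hQ (n := n + 1) (by push_cast; exact hn)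
  have h2 : posSq (1 / 2 * (((n : ℝ) + 1) * drift D)) ≤
      posSq ((1 - p.delta ^ 2) * (-drift D + ((n + 1 : ℕ) + 1) * drift D)) :=
    -- The `n + 2` drifts of this level minus the initial one leave `n + 1`.
    posSq_mul_le (by norm_num) (by linarith [hp.delta_sq_le]) fun _ => by push_cast; linarith
  have h3 : posSq (1 / 2 * (((n : ℝ) + 1) * drift D)) = ((n : ℝ) + 1) ^ 2 * D / 25600 := by
    rw [posSq, max_eq_right (by positivity), mul_pow, mul_pow, hd2]
    ring
  rw [h3] at h2
  have e : level Q D p (-drift D) (n + 1) = ((1 / 2) ^ (n + 1) * stretch Q ^ (n + 1)) *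
      posSq ((1 - p.delta ^ 2) * (-drift D + ((n + 1 : ℕ) + 1) * drift D)) * (p.al / (8 * D)) := by
    rw [level, pow_succ (1 / 2 : ℝ) (n + 1)]
    field_simp
    ring
  rw [e]
  calc p.al * ((n : ℝ) + 1) ^ 2 / 409600
      = 1 / 2 * (((n : ℝ) + 1) ^ 2 * D / 25600) * (p.al / (8 * D)) := by
        field_simp
        norm_num
    _ ≤ _ := by gcongr

theorem cube_le_sum_sq (m : ℕ) :
    (m : ℝ) ^ 3 / 3 ≤ ∑ n ∈ Finset.range m, ((n : ℝ) + 1) ^ 2 := by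
  induction m with
  | zero => simp
  | succ m ih =>
    rw [Finset.sum_range_succ]
    push_cast
    have : (0 : ℝ) ≤ m := m.cast_nonneg
    nlinarith

theorem energy_zero_ge_cube (hQ : 10 ≤ Q) {N : ℕ} (hN : ⌊Q⌋₊ + 1 ≤ N) {e : Plane}
    (hp : p.Valid Q D) (h : Aligned p a b e) (hb : 0 ≤ inner ℝ b e) :
    p.al * Q ^ 3 / 9830400 ≤ Tree.energy e (weightTree Q N p a b) 0 0 := by
  obtain ⟨N, rfl⟩ := Nat.exists_eq_add_of_le' (le_add_self.trans hN : 1 ≤ N)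
  have hm : ⌊Q⌋₊ ≤ N := by omega
  have hal := hp.al_pos
  have hQm : Q / 2 ≤ ⌊Q⌋₊ := by
    have := Nat.lt_floor_add_one Q
    linarith
  refine le_trans ?_ (energy_zero_ge hQ N hp h hb)
  -- `9830400 = 409600 · 8 · 3`: the `8` comes from `Q/2 ≤ ⌊Q⌋₊`, the `3` from the sum of squares.
  calc p.al * Q ^ 3 / 9830400 = p.al / 409600 * ((Q / 2) ^ 3 / 3) := by ring
    _ ≤ p.al / 409600 * ((⌊Q⌋₊ : ℝ) ^ 3 / 3) := by gcongr
    _ ≤ p.al / 409600 * ∑ n ∈ Finset.range ⌊Q⌋₊, ((n : ℝ) + 1) ^ 2 := by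
        gcongr
        exact cube_le_sum_sq _
    _ = ∑ n ∈ Finset.range ⌊Q⌋₊, p.al * ((n : ℝ) + 1) ^ 2 / 409600 := by
        rw [Finset.mul_sum]
        exact Finset.sum_congr rfl fun _ _ => by ring
    _ ≤ ∑ n ∈ Finset.range ⌊Q⌋₊, level Q D p (-drift D) (n + 1) := by
        refine Finset.sum_le_sum fun n hn => le_level_succ hQ hp ?_
        have h1 : ((n + 1 : ℕ) : ℝ) ≤ ⌊Q⌋₊ := by exact_mod_cast Finset.mem_range.1 hn
        have h2 : (⌊Q⌋₊ : ℝ) ≤ Q := Nat.floor_le (by linarith)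
        push_cast at h1
        linarith
    _ ≤ ∑ n ∈ Finset.range N, level Q D p (-drift D) (n + 1) := by
        refine Finset.sum_le_sum_of_subset_of_nonneg (Finset.range_mono hm) fun n _ _ => ?_
        have := (stretch_bounds hQ).1
        have := hp.det_pos
        have := posSq_nonneg ((1 - p.delta ^ 2) * (-drift D + ((n + 1 : ℕ) + 1) * drift D))
        unfold level
        positivity

end recursion

theorem axes_of_orthonormalBasis (u : OrthonormalBasis (Fin 2) ℝ Plane) : Axes (u 0) (u 1) := by
  constructor <;> simp [u.inner_eq_ite, -inner_self_eq_norm_sq_to_K]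

end HaarLower

end

/-! ### Choice of the constants and conclusion. -/

open HaarLower in
theorem theorem5 :
    ∃ c : ℝ, 0 < c ∧ ∃ Q₀ : ℝ, 1 ≤ Q₀ ∧ ∀ Q : ℝ, Q₀ ≤ Q →
      ∃ δs : ℝ, 0 < δs ∧ ∀ δ₀ : ℝ, 0 < δ₀ → δ₀ < δs →
        ∃ N₀ : ℕ, ∀ N : ℕ, N₀ ≤ N → ∀ α₀ : ℝ, 0 < α₀ →
          ∀ u : OrthonormalBasis (Fin 2) ℝ HaarLower.Plane,
          ∀ W : ℝ → HaarLower.Mat, W = HaarLower.weight Q δ₀ α₀ u N →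
            (HaarLower.IsMatrixWeight W ∧ (∀ x ∈ HaarLower.unitInterval, (W x).PosDef) ∧
                HaarLower.IsMatrixWeight (fun x => (W x)⁻¹) ∧
                HaarLower.HasDyadicA2Char W Q) ∧
              ∀ e : HaarLower.Plane, (e = u 0 ∨ e = u 0 + u 1) →
                ∀ f : ℝ → HaarLower.Plane, f = HaarLower.testFunction W e →
                  HaarLower.MemL2 W f ∧ 0 < HaarLower.normL2 W f ∧
                  {I : HaarLower.DyadicInterval | HaarLower.haarCoeff f I ≠ 0}.Finite ∧
                  HaarLower.MemL2 W (HaarLower.haarShift f) ∧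
                  c * Q ^ (3 / 2 : ℝ) * HaarLower.normL2 W f ≤
                    HaarLower.normL2 W (HaarLower.haarShift f) := by
  -- The bound `1/40` on `δ₀` is the one required by `Aligned`; one generation beyond `⌊Q⌋₊` makes
  -- up for the missing drift at the top. The value of `c` works since `2 c² ≤ 1/9830400`.
  refine ⟨1 / 10000, by norm_num, 10, by norm_num, fun Q hQ => ⟨1 / 40, by norm_num,
    fun δ₀ hδ hδ' => ⟨⌊Q⌋₊ + 1, fun N hN α₀ hα u W hW => ?_⟩⟩⟩
  have hab := axes_of_orthonormalBasis u
  have hp := Eig.initial_valid (Q := Q) hδ (by linarith) hα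
  set p := Eig.initial Q δ₀ α₀ with hpdef
  have hδp : p.delta = δ₀ := Eig.initial_delta hδ hα
  have ht := isWeightTree_weightTree hQ N hp hab
  have hW' : W = (weightTree Q N p (u 0) (u 1)).eval := by
    rw [hW]
    exact funext fun x => (weightTree_eval Q N p _ _ x).symm
  have hinv : (fun x => (W x)⁻¹) = ((weightTree Q N p (u 0) (u 1)).map fun A => A⁻¹).eval := by
    rw [hW']
    exact funext fun x => (Tree.eval_map (fun A : Mat => A⁻¹) _ x).symm
  refine ⟨⟨?_, ?_, ?_, ?_⟩, ?_⟩
  · rw [hW']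
    exact Tree.isMatrixWeight ht.posDef
  · rw [hW']
    exact fun x _ => ht.posDef.eval x
  · rw [hinv]
    exact Tree.isMatrixWeight ht.posDef.inv
  · rw [hW']
    exact hasDyadicA2Char_weightTree hQ N hp hab
  · rintro e he f rfl
    have hal : p.al = α₀ := rfl
    have ha : inner ℝ (u 0) e = (1 : ℝ) := by
      rcases he with rfl | rfl
      · exact hab.aa
      · rw [inner_add_right, hab.aa, hab.ab, add_zero]
    have hb : inner ℝ (u 1) e = (0 : ℝ) ∨ inner ℝ (u 1) e = (1 : ℝ) := by
      rcases he with rfl | rfl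
      · exact Or.inl hab.ba
      · exact Or.inr (by rw [inner_add_right, hab.bb, hab.ba, zero_add])
    have hb0 : 0 ≤ inner ℝ (u 1) e := by rcases hb with h | h <;> rw [h]; exact zero_le_one
    have hb1 : inner ℝ (u 1) e ^ 2 ≤ 1 := by rcases hb with h | h <;> rw [h] <;> norm_num
    have hal' : Aligned p (u 0) (u 1) e := by
      refine ⟨hab, by rw [hδp]; linarith, ?_, by rw [hδp, ha]; linarith⟩
      rw [hab.inner_self, ha]
      linarith
    have hf : inner ℝ e (act (diagMat (u 0) (u 1) p.al p.be) e) =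
        p.al + p.be * inner ℝ (u 1) e ^ 2 := by
      rw [real_inner_comm, ← quad, quad_diagMat, ha]
      ring
    have hbe := hp.be_pos
    have hble := hp.be_le
    have halp := hp.al_pos
    have hE := energy_zero_ge_cube hQ hN hp hal' hb0
    rw [hW']
    refine ⟨Tree.memL2_testFunction ht.posDef e, ?_, ?_, Tree.memL2_haarShift _ e, ?_⟩
    · rw [Tree.normL2_testFunction ht.posDef, ht.meanInv, hf]
      positivity
    · rw [Tree.testFunction_eval]
      exact finite_haarCoeff_ne_zero _
    · rw [Tree.normL2_testFunction ht.posDef, ht.meanInv, hf, Tree.normL2_haarShift]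
      refine Real.le_sqrt_of_sq_le (le_trans ?_ hE)
      have hQ3 : (Q ^ (3 / 2 : ℝ)) ^ 2 = Q ^ 3 := by
        rw [← Real.rpow_natCast, ← Real.rpow_mul (by linarith), ← Real.rpow_natCast]
        norm_num
      rw [mul_pow, mul_pow, hQ3, Real.sq_sqrt (by positivity)]
      have h1 : p.al + p.be * inner ℝ (u 1) e ^ 2 ≤ 2 * p.al := by nlinarith
      have h2 : 0 < Q ^ 3 := by positivity
      calc (1 / 10000 : ℝ) ^ 2 * Q ^ 3 * (p.al + p.be * inner ℝ (u 1) e ^ 2)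
          ≤ (1 / 10000 : ℝ) ^ 2 * Q ^ 3 * (2 * p.al) := by gcongr
        _ ≤ p.al * Q ^ 3 / 9830400 := by nlinarith [mul_pos halp h2]
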